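/- **Setting.** Let $\Gamma=\bigcup_{\gamma\in\mathcal E}\gamma([0,1])\subset\mathbb R^N$ be an embedded network: $\mathcal E$ is a nonempty finite set of regular simple $C^1$ curves (arcs) parametrized on $[0,1]$, possibly closed, containing with each $\gamma$ its inverse $\widetilde\gamma(s)=\gamma(1-s)$; the interiors $\gamma((0,1))$, $\gamma'((0,1))$ are disjoint if $\gamma\ne\gamma'$ and $\gamma\neq\widetilde{\gamma'}$; no vertex (endpoint of an arc) lies in the interior of an arc; and any two vertices are linked by a finite concatenation of arcs. Let $\mathcal H=\{H_\gamma\}_{\gamma\in\mathcal E}$, where each $H_\gamma:[0,1]\times\mathbb R\to\mathbb R$ is continuous, and coercive and quasiconvex in $p$, with $\mathrm{Int}\{p: H_\gamma(s,p)\le b\}=\{p: H_\gamma(s,p)<b\}$ for all $s\in[0,1]$ and $b\in\mathbb R$, and $H_{\widetilde\gamma}(s,p)=H_\gamma(1-s,-p)$. Put $a_\gamma=\max_s\min_p H_\gamma(s,p)$, and let $c_\gamma$ be the least $b$ for which $H_\gamma(s,w')=b$ has a viscosity subsolution in $(0,1)$ that is continuous on $[0,1]$ with $w(0)=w(1)$.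 Let $a_0$ be the maximum of all $a_\gamma$ with $\gamma$ not closed and all $c_\gamma$ with $\gamma$ closed. Assume that $s\mapsto\min_pH_\gamma(s,p)$ is constant on $[0,1]$ for every $\gamma$ with $a_\gamma=a_0$. For $a\ge a_0$ let $\sigma_a^{\gamma}(s)=\max\{p: H_\gamma(s,p)=a\}$ and $\sigma_a(\gamma)=\int_0^1\sigma_a^\gamma(t)\,dt$. The critical value $c$ is the least $a\ge a_0$ for which there is a function $u$ on the vertices with $u(\gamma(0))\le u(\gamma(1))+\sigma_a(\widetilde\gamma)$ for all $\gamma\in\mathcal E$. The Aubry arcs are the arcs that belong to some cycle $(\gamma_1,\dots,\gamma_M)$ of concatenated arcs with $\sum_i\sigma_c(\gamma_i)=0$, and the Aubry set $\mathcal A_\Gamma$ is the union of their supports. For $a\ge c$ and $x,y\in\Gamma$ let $S_a^\Gamma(x,y)$ be the minimum of $\sum_i\int_{s_i}^{t_i}\sigma_a^{\gamma_i}(t)\,dt$ over all finite concatenations of portions of arcs $\gamma_i|_{[s_i,t_i]}$, $0\le s_i\le t_i\le 1$, leading from $x$ to $y$. Let $U\subset\Gamma$ be relatively open. A continuous function $u:\Gamma\to\mathbb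 R$ is a solution of $\mathcal H(x,Du)=a$ in $U$ if for all $\gamma\in\mathcal E$ and $s\in(0,1)$ with $\gamma(s)\in U$ the function $u\circ\gamma$ satisfies the viscosity solution condition for $H_\gamma(s,(u\circ\gamma)')=a$ at $s$, and for every vertex $x\in U$ there is $\gamma\in\mathcal E$ with $\gamma(1)=x$ such that $H_\gamma(1,\varphi'(1))\ge a$ for every $C^1$ function $\varphi$ with $\varphi(1)=u(\gamma(1))$ and $\varphi\le u\circ\gamma$ in $(1-\delta,1)$ for some $\delta>0$. **Theorem.** Let $a\ge c$, let $\Gamma'$ be a nonempty closed subset of $\Gamma$ and $g:\Gamma'\to\mathbb R$ an admissible trace, that is, $g(x)-g(y)\le S_a^\Gamma(y,x)$ for all $x,y\in\Gamma'$. For $x\in\Gamma$ set $$v(x)=\min\{g(y)+S_a^\Gamma(y,x)\;:\;y\in\Gamma'\}.$$ Then: 1. (Critical case) If $a=c$, $\Gamma'\subset\mathcal A_\Gamma$, and $\Gamma'$ meets the support $\gamma([0,1])$ of every Aubry arc $\gamma$, then the minimum is attained for every $x\in\Gamma$, and $v$ is a solution of $\mathcal H(x,Du)=c$ in $\Gamma$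 equal to $g$ on $\Gamma'$, and it is the only one. 2. (Supercritical case) If $a>c$, then the minimum is attained for every $x\in\Gamma$, and $v$ is continuous on $\Gamma$, is a solution of $\mathcal H(x,Du)=a$ in $\Gamma\setminus\Gamma'$ and equals $g$ on $\Gamma'$, and it is the only function on $\Gamma$ with these properties. -/

import Mathlib

open Set Filter Topology

/-- An embedded network in `ℝ^N`: finitely many regular simple arcs `arc e : [0,1] → ℝ^N`, indexed
by the (oriented) edges `e : E` of the underlying abstract graph. The family is closed under
reversal of the orientation. Only the values of `arc e` on `[0,1]` matter. -/
structure EmbeddedNetwork (N : ℕ) (E : Type*) where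
  arc : E → ℝ → EuclideanSpace ℝ (Fin N)
  /-- the reversed edge -/
  rev : E → E
  rev_rev : ∀ e, rev (rev e) = e
  rev_ne : ∀ e, rev e ≠ e
  contDiffOn_arc : ∀ e, ContDiffOn ℝ 1 (arc e) (Icc 0 1)
  regular_arc : ∀ e, ∀ s ∈ Icc (0 : ℝ) 1, derivWithin (arc e) (Icc 0 1) s ≠ 0
  /-- arcs are simple curves; they may be closed -/
  simple_arc : ∀ e, ∀ s ∈ Icc (0 : ℝ) 1, ∀ t ∈ Icc (0 : ℝ) 1, s < t →
    arc e s = arc e t → s = 0 ∧ t = 1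
  arc_rev : ∀ e, ∀ s ∈ Icc (0 : ℝ) 1, arc (rev e) s = arc e (1 - s)
  /-- different arcs that are not inverse to each other have disjoint interiors -/
  disjoint_arc : ∀ e e', e ≠ e' → e ≠ rev e' →
    Disjoint (arc e '' Ioo 0 1) (arc e' '' Ioo 0 1)
  /-- no vertex lies in the interior of an arc -/
  interior_ne_vertex : ∀ e e', ∀ s ∈ Ioo (0 : ℝ) 1, arc e s ≠ arc e' 0 ∧ arc e s ≠ arc e' 1
  /-- any two vertices are linked by a finite concatenation of arcs -/
  connected : ∀ e e', Relation.ReflTransGen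
    (fun x y => ∃ d, arc d 0 = x ∧ arc d 1 = y) (arc e 0) (arc e' 0)

/-- A portion `γ|[s₁,s₂]` of the arc `γ` with index `edge`. -/
structure ArcPortion (E : Type*) where
  edge : E
  s₁ : ℝ
  s₂ : ℝ
  zero_le : 0 ≤ s₁
  le : s₁ ≤ s₂
  le_one : s₂ ≤ 1

namespace EmbeddedNetwork

variable {N : ℕ} {E : Type*} (Γ : EmbeddedNetwork N E)

/-- The network as a subset of `ℝ^N`. -/
def support : Set (EuclideanSpace ℝ (Fin N)) := ⋃ e, Γ.arc e '' Icc 0 1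

def vertices : Set (EuclideanSpace ℝ (Fin N)) := {x | ∃ e, Γ.arc e 0 = x ∨ Γ.arc e 1 = x}

/-- The list of edges is concatenated and leads from `x` to `y`
(the empty list leads from `x` to `x`). -/
def IsPath : List E → EuclideanSpace ℝ (Fin N) → EuclideanSpace ℝ (Fin N) → Prop
  | [], x, y => x = y
  | e :: ξ, x, y => Γ.arc e 0 = x ∧ IsPath ξ (Γ.arc e 1) y

/-- A cycle: a non-empty path whose initial and final vertices coincide. -/
def IsCycle (ξ : List E) : Prop := ξ ≠ [] ∧ ∃ x, Γ.IsPath ξ x x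

/-- The portions of arcs are concatenated and form a curve on the network from `x` to `y`
(the empty list is the constant curve). -/
def IsCurve : List (ArcPortion E) → EuclideanSpace ℝ (Fin N) → EuclideanSpace ℝ (Fin N) → Prop
  | [], x, y => x = y
  | p :: ξ, x, y => Γ.arc p.edge p.s₁ = x ∧ IsCurve ξ (Γ.arc p.edge p.s₂) y

end EmbeddedNetwork

/-- A Hamiltonian on a network: a Hamiltonian `H_γ : [0,1] × ℝ → ℝ` on every arc, compatible with
reversal of the arc, continuous, coercive and quasiconvex in `p`, and such that the interior of
each sublevel set in `p` is the strict sublevel set.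
Only the values for `s ∈ [0,1]` matter. -/
structure NetworkHamiltonian {N : ℕ} {E : Type*} (Γ : EmbeddedNetwork N E) where
  H : E → ℝ → ℝ → ℝ
  H_rev : ∀ e, ∀ s ∈ Icc (0 : ℝ) 1, ∀ p, H (Γ.rev e) s p = H e (1 - s) (-p)
  continuousOn_H : ∀ e, ContinuousOn (fun z : ℝ × ℝ => H e z.1 z.2) (Icc 0 1 ×ˢ univ)
  coercive_H : ∀ e, ∀ s ∈ Icc (0 : ℝ) 1, Tendsto (H e s) (cocompact ℝ) atTop
  quasiconvex_H : ∀ e, ∀ s ∈ Icc (0 : ℝ) 1, QuasiconvexOn ℝ univ (H e s)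
  interior_H : ∀ e, ∀ s ∈ Icc (0 : ℝ) 1, ∀ a, interior {p | H e s p ≤ a} = {p | H e s p < a}

/-- Viscosity subsolution condition at the point `s` for `H(s, w') = a`:
the test functions touch `w` from above at `s`. -/
def IsViscSubAt (H : ℝ → ℝ → ℝ) (a : ℝ) (w : ℝ → ℝ) (s : ℝ) : Prop :=
  ∀ φ : ℝ → ℝ, ContDiff ℝ 1 φ → φ s = w s → (∀ᶠ t in 𝓝 s, w t ≤ φ t) → H s (deriv φ s) ≤ a

/-- Viscosity supersolution condition at the point `s` for `H(s, w') = a`: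
the test functions touch `w` from below at `s`. -/
def IsViscSuperAt (H : ℝ → ℝ → ℝ) (a : ℝ) (w : ℝ → ℝ) (s : ℝ) : Prop :=
  ∀ φ : ℝ → ℝ, ContDiff ℝ 1 φ → φ s = w s → (∀ᶠ t in 𝓝 s, φ t ≤ w t) → a ≤ H s (deriv φ s)

/-- State constraint boundary condition at `s = 1` for `H(s, w') = a`:
the test functions touch `w` from below at `1`, relative to the left of `1`. -/
def StateConstraintAtOne (H : ℝ → ℝ → ℝ) (a : ℝ) (w : ℝ → ℝ) : Prop :=
  ∀ φ : ℝ → ℝ, ContDiff ℝ 1 φ → φ 1 = w 1 → (∀ᶠ t in 𝓝[<] 1, φ t ≤ w t) → a ≤ H 1 (deriv φ 1)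

/-- Periodic subsolutions of `H(s, w') = a` in `(0,1)`. -/
def IsPeriodicSubsolution (H : ℝ → ℝ → ℝ) (a : ℝ) (w : ℝ → ℝ) : Prop :=
  ContinuousOn w (Icc 0 1) ∧ (∀ s ∈ Ioo (0 : ℝ) 1, IsViscSubAt H a w s) ∧ w 0 = w 1

namespace NetworkHamiltonian

variable {N : ℕ} {E : Type*} {Γ : EmbeddedNetwork N E} (𝓗 : NetworkHamiltonian Γ)

/-- `min_p H_γ(s,p)`. -/
noncomputable def minH (e : E) (s : ℝ) : ℝ := ⨅ p, 𝓗.H e s p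

/-- `a_γ = max_{s ∈ [0,1]} min_p H_γ(s,p)`. -/
noncomputable def aArc (e : E) : ℝ := sSup (𝓗.minH e '' Icc 0 1)

/-- `c_γ`: the least level at which the equation on `γ` has periodic subsolutions. -/
noncomputable def cArc (e : E) : ℝ := sInf {a | ∃ w, IsPeriodicSubsolution (𝓗.H e) a w}

open Classical in
/-- `a₀`: the maximum of all `c_γ` with `γ` closed and all `a_γ` with `γ` not closed. -/
noncomputable def a₀ : ℝ := ⨆ e, if Γ.arc e 0 = Γ.arc e 1 then 𝓗.cArc e else 𝓗.aArc e

/-- On every arc with `a_γ = a₀` the function `s ↦ min_p H_γ(s,p)` is constant. -/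
def ConstantMinOnExtremalArcs : Prop :=
  ∀ e, 𝓗.aArc e = 𝓗.a₀ → ∃ m, ∀ s ∈ Icc (0 : ℝ) 1, 𝓗.minH e s = m

/-- `σ_a⁺(s) = max {p | H_γ(s,p) = a}`. -/
noncomputable def sigmaPlus (a : ℝ) (e : E) (s : ℝ) : ℝ := sSup {p | 𝓗.H e s p = a}

/-- The intrinsic length `ℓ_a` of a portion of an arc. -/
noncomputable def portionLength (a : ℝ) (p : ArcPortion E) : ℝ :=
  ∫ t in p.s₁..p.s₂, 𝓗.sigmaPlus a p.edge t

/-- The intrinsic length `ℓ_a` of a concatenation of portions of arcs. -/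
noncomputable def curveLength (a : ℝ) (ξ : List (ArcPortion E)) : ℝ :=
  (ξ.map (𝓗.portionLength a)).sum

/-- The intrinsic semidistance `S_a^Γ(x,y)` on the network: the least length of a curve on the
network that links `x` to `y`. -/
noncomputable def semidistance (a : ℝ) (x y : EuclideanSpace ℝ (Fin N)) : ℝ :=
  sInf {l | ∃ ξ, Γ.IsCurve ξ x y ∧ 𝓗.curveLength a ξ = l}

/-- The cochain `σ_a(e)` on the edges. For the reversed edge it equals `-∫₀¹ σ_a⁻`. -/
noncomputable def sigma (a : ℝ) (e : E) : ℝ := ∫ t in (0 : ℝ)..1, 𝓗.sigmaPlus a e t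

/-- Subsolutions `u` (on the vertices) of the discrete functional equation
`u(x) = min_{o(e) = x} (u(t(e)) + σ_a(-e))`. -/
def IsDiscreteSubsolution (a : ℝ) (u : EuclideanSpace ℝ (Fin N) → ℝ) : Prop :=
  ∀ x ∈ Γ.vertices, ∀ e, Γ.arc e 0 = x → u x ≤ u (Γ.arc e 1) + 𝓗.sigma a (Γ.rev e)

/-- The critical value `c`: the least `a ≥ a₀` for which the discrete functional equation admits
subsolutions. -/
noncomputable def criticalValue : ℝ := sInf {a | 𝓗.a₀ ≤ a ∧ ∃ u, 𝓗.IsDiscreteSubsolution a u}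

/-- The Aubry set on the abstract graph: the edges that belong to a cycle `ξ` with `σ_c(ξ) = 0`. -/
def aubryEdges : Set E :=
  {e | ∃ ξ : List E, Γ.IsCycle ξ ∧ (ξ.map (𝓗.sigma 𝓗.criticalValue)).sum = 0 ∧ e ∈ ξ}

/-- The Aubry set on the network. -/
def aubrySet : Set (EuclideanSpace ℝ (Fin N)) :=
  {x | ∃ e ∈ 𝓗.aubryEdges, ∃ t ∈ Icc (0 : ℝ) 1, x = Γ.arc e t}

/-- `u` is a (continuous) solution of `𝓗(x, Du) = a` in `U`, a relatively open subset of the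
network. With `U = Γ.support` this is the notion of solution on the whole network. -/
def IsSolutionIn (a : ℝ) (U : Set (EuclideanSpace ℝ (Fin N)))
    (u : EuclideanSpace ℝ (Fin N) → ℝ) : Prop :=
  ContinuousOn u Γ.support ∧
  (∀ e, ∀ s ∈ Ioo (0 : ℝ) 1, Γ.arc e s ∈ U →
    IsViscSubAt (𝓗.H e) a (fun t => u (Γ.arc e t)) s ∧
    IsViscSuperAt (𝓗.H e) a (fun t => u (Γ.arc e t)) s) ∧
  (∀ x ∈ Γ.vertices ∩ U, ∃ e, Γ.arc e 1 = x ∧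
    StateConstraintAtOne (𝓗.H e) a (fun t => u (Γ.arc e t)))

/-- `g` is an admissible trace on `Γ'` at the level `a`. -/
def IsAdmissibleTrace (a : ℝ) (Γ' : Set (EuclideanSpace ℝ (Fin N)))
    (g : EuclideanSpace ℝ (Fin N) → ℝ) : Prop :=
  ∀ x ∈ Γ', ∀ y ∈ Γ', g x - g y ≤ 𝓗.semidistance a y x

/-- The values `g(y) + S_a^Γ(y,x)`, `y ∈ Γ'`. -/
def hopfLaxValues (a : ℝ) (Γ' : Set (EuclideanSpace ℝ (Fin N)))
    (g : EuclideanSpace ℝ (Fin N) → ℝ) (x : EuclideanSpace ℝ (Fin N)) : Set ℝ :=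
  (fun y => g y + 𝓗.semidistance a y x) '' Γ'

/-- `v(x) = min_{y ∈ Γ'} (g(y) + S_a^Γ(y,x))`. -/
noncomputable def hopfLax (a : ℝ) (Γ' : Set (EuclideanSpace ℝ (Fin N)))
    (g : EuclideanSpace ℝ (Fin N) → ℝ) (x : EuclideanSpace ℝ (Fin N)) : ℝ :=
  sInf (𝓗.hopfLaxValues a Γ' g x)

end NetworkHamiltonian

/-! ### Quasiconvex coercive functions of one variable -/

section Slice

variable {h : ℝ → ℝ} {a b p q : ℝ}

/-! At each point of an arc the slopes with `H ≤ a` form an interval from `sigmaMinus` to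
`sigmaPlus`, with `H < a` strictly inside. Hence being a subsolution is an integral condition
(`IsSub`): increments along arcs are bounded by the primitives of these endpoints, and so increments
on the network are bounded by the semidistance. The Hopf–Lax function is then the largest
subsolution below `g` on `Γ'`, and admissibility says that it attains `g` there.

Existence is a Perron argument. Off `Γ'` maximality forces `v` to be transported along an arc with
equality: otherwise `exists_isSub_extension` produces a competitor that is too large. Equality means
that a primitive of slope `sigmaPlus` or `sigmaMinus` touches `v` from above, which gives the
supersolution and vertex conditions. In the critical case points of `Γ'` need another reason: around
a cycle of zero length every subsolution inequality is an equality, so any subsolution is a solution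
on the Aubry set.

For uniqueness, a solution `u` with trace `g` satisfies `IsSub`, whence `u ≤ v`. If `u < v` at a
vertex, the vertex condition gives an incoming arc along which `u` is transported with equality.
This arc misses `Γ'`, because `u = v` there, and starts at a vertex where again `u < v`. Going
backwards in a finite graph closes a cycle of zero length that misses `Γ'`. Above the critical value
no such cycle exists; at the critical value its arcs are Aubry arcs and meet `Γ'`.

The constancy hypothesis yields a dichotomy for each arc: either strict subsolutions exist along it,
so that comparison applies, or `sigmaMinus = sigmaPlus` throughout and every subsolution has forced
increments. It also enters in the proof that the Aubry set is nonempty. -/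

theorem QuasiconvexOn.lt_of_level_lt (hq : QuasiconvexOn ℝ univ h) {x y z : ℝ} (hxy : x < y)
    (hx : h x ≤ b) (hy : b < h y) (hz : h z ≤ b) : z < y := by
  by_contra! hyz
  have hc := (hq b).ordConnected
  have := hc.out (x := x) ⟨trivial, hx⟩ (y := z) ⟨trivial, hz⟩ ⟨hxy.le, hyz⟩
  exact absurd this.2 (not_le.2 hy)

theorem QuasiconvexOn.gt_of_level_lt (hq : QuasiconvexOn ℝ univ h) {x y z : ℝ} (hxy : y < x)
    (hx : h x ≤ b) (hy : b < h y) (hz : h z ≤ b) : y < z := by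
  by_contra! hyz
  have hc := (hq b).ordConnected
  have := hc.out (x := z) ⟨trivial, hz⟩ (y := x) ⟨trivial, hx⟩ ⟨hyz, hxy.le⟩
  exact absurd this.2 (not_le.2 hy)

theorem bddAbove_sublevel_of_coercive (ht : Tendsto h (cocompact ℝ) atTop) (a : ℝ) :
    BddAbove {p | h p ≤ a} := by
  rw [cocompact_eq_atBot_atTop, tendsto_sup] at ht
  obtain ⟨M, hM⟩ := (ht.2.eventually_gt_atTop a).exists_forall_of_atTop
  exact ⟨M, fun p hp => by by_contra! hlt; exact absurd hp (not_le.2 (hM p hlt.le))⟩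

/-- By coercivity and the intermediate value theorem, every point of the sublevel has a point of
level exactly `a` to its right. So the supremum of the level set bounds the whole sublevel. -/
theorem isGreatest_sublevel_of_coercive (hc : Continuous h)
    (ht : Tendsto h (cocompact ℝ) atTop) (hp : h p ≤ a) :
    h (sSup {p | h p = a}) = a ∧ ∀ q, h q ≤ a → q ≤ sSup {p | h p = a} := by
  have hbdd := bddAbove_sublevel_of_coercive ht a
  have hbdd' : BddAbove {p | h p = a} := hbdd.mono fun p hp => le_of_eq hp
  have key : ∀ q, h q ≤ a → ∃ r, q ≤ r ∧ h r = a := by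
    intro q hq
    rw [cocompact_eq_atBot_atTop, tendsto_sup] at ht
    obtain ⟨M, hM, hqM⟩ := ((ht.2.eventually_ge_atTop a).and (eventually_ge_atTop q)).exists
    obtain ⟨r, hr, hra⟩ := intermediate_value_Icc hqM hc.continuousOn ⟨hq, hM⟩
    exact ⟨r, hr.1, hra⟩
  refine ⟨?_, fun q hq => ?_⟩
  · obtain ⟨r, -, hr⟩ := key p hp
    have hcl : IsClosed {p | h p = a} := isClosed_eq hc continuous_const
    exact hcl.csSup_mem ⟨r, hr⟩ hbdd'
  · obtain ⟨r, hqr, hr⟩ := key q hq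
    exact hqr.trans (le_csSup hbdd' hr)

end Slice

/-! ### Endpoints of the sublevel intervals and their continuity in `s` and in the level. -/

namespace NetworkHamiltonian

variable {N : ℕ} {E : Type*} {Γ : EmbeddedNetwork N E} (𝓗 : NetworkHamiltonian Γ)
  {a b : ℝ} {e : E} {s : ℝ}

/-- Every sublevel set of `H_γ(s, ·)` at the level `a` is non-empty. -/
def LevelNonempty (a : ℝ) (e : E) : Prop := ∀ s ∈ Icc (0 : ℝ) 1, ∃ p, 𝓗.H e s p ≤ a

/-- `σ_a⁻(s) = min {p | H_γ(s,p) = a}`. -/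
noncomputable def sigmaMinus (a : ℝ) (e : E) (s : ℝ) : ℝ := -𝓗.sigmaPlus a (Γ.rev e) (1 - s)

theorem one_sub_mem (hs : s ∈ Icc (0 : ℝ) 1) : 1 - s ∈ Icc (0 : ℝ) 1 :=
  ⟨by linarith [hs.2], by linarith [hs.1]⟩

variable {𝓗}

theorem continuous_slice (hs : s ∈ Icc (0 : ℝ) 1) : Continuous (𝓗.H e s) := by
  have := (𝓗.continuousOn_H e).comp (f := fun p : ℝ => (s, p)) (s := univ)
    (by fun_prop) (fun p _ => ⟨hs, trivial⟩)
  exact continuousOn_univ.1 this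

theorem eventually_slice_lt {p : ℝ} (hs : s ∈ Icc (0 : ℝ) 1) (h : 𝓗.H e s p < b) :
    ∀ᶠ t in 𝓝[Icc 0 1] s, 𝓗.H e t p < b := by
  have := (𝓗.continuousOn_H e).comp (f := fun t : ℝ => (t, p)) (s := Icc 0 1)
    (by fun_prop) (fun t ht => ⟨ht, trivial⟩)
  exact (this s hs).eventually_lt_const h

theorem eventually_lt_slice {p : ℝ} (hs : s ∈ Icc (0 : ℝ) 1) (h : b < 𝓗.H e s p) :
    ∀ᶠ t in 𝓝[Icc 0 1] s, b < 𝓗.H e t p := by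
  have := (𝓗.continuousOn_H e).comp (f := fun t : ℝ => (t, p)) (s := Icc 0 1)
    (by fun_prop) (fun t ht => ⟨ht, trivial⟩)
  exact (this s hs).eventually_const_lt h

theorem H_rev' (hs : s ∈ Icc (0 : ℝ) 1) (p : ℝ) : 𝓗.H (Γ.rev e) (1 - s) (-p) = 𝓗.H e s p := by
  rw [𝓗.H_rev e _ (one_sub_mem hs)]; simp

theorem LevelNonempty.rev (h : 𝓗.LevelNonempty a e) : 𝓗.LevelNonempty a (Γ.rev e) := by
  intro s hs
  obtain ⟨p, hp⟩ := h (1 - s) (one_sub_mem hs)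
  exact ⟨-p, by rw [𝓗.H_rev e s hs]; simpa using hp⟩

theorem LevelNonempty.mono (h : 𝓗.LevelNonempty a e) (hab : a ≤ b) : 𝓗.LevelNonempty b e :=
  fun s hs => (h s hs).imp fun _ hp => hp.trans hab

theorem H_sigmaPlus (h : 𝓗.LevelNonempty a e) (hs : s ∈ Icc (0 : ℝ) 1) :
    𝓗.H e s (𝓗.sigmaPlus a e s) = a := by
  obtain ⟨p, hp⟩ := h s hs
  exact (isGreatest_sublevel_of_coercive (continuous_slice hs) (𝓗.coercive_H e s hs) hp).1

theorem le_sigmaPlus {p : ℝ} (hs : s ∈ Icc (0 : ℝ) 1) (hp : 𝓗.H e s p ≤ a) :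
    p ≤ 𝓗.sigmaPlus a e s :=
  (isGreatest_sublevel_of_coercive (continuous_slice hs) (𝓗.coercive_H e s hs) hp).2 p hp

theorem H_sigmaMinus (h : 𝓗.LevelNonempty a e) (hs : s ∈ Icc (0 : ℝ) 1) :
    𝓗.H e s (𝓗.sigmaMinus a e s) = a := by
  rw [← H_rev' hs, sigmaMinus, neg_neg, H_sigmaPlus h.rev (one_sub_mem hs)]

theorem sigmaMinus_le {p : ℝ} (hs : s ∈ Icc (0 : ℝ) 1) (hp : 𝓗.H e s p ≤ a) :
    𝓗.sigmaMinus a e s ≤ p := by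
  rw [← H_rev' hs] at hp
  have := le_sigmaPlus (one_sub_mem hs) hp
  unfold sigmaMinus; linarith

theorem sigmaMinus_le_sigmaPlus (h : 𝓗.LevelNonempty a e) (hs : s ∈ Icc (0 : ℝ) 1) :
    𝓗.sigmaMinus a e s ≤ 𝓗.sigmaPlus a e s :=
  le_sigmaPlus hs (H_sigmaMinus h hs).le

theorem H_le_of_mem {p : ℝ} (h : 𝓗.LevelNonempty a e) (hs : s ∈ Icc (0 : ℝ) 1)
    (hp : p ∈ Icc (𝓗.sigmaMinus a e s) (𝓗.sigmaPlus a e s)) : 𝓗.H e s p ≤ a :=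
  ((𝓗.quasiconvex_H e s hs a).ordConnected.out ⟨trivial, (H_sigmaMinus h hs).le⟩
    ⟨trivial, (H_sigmaPlus h hs).le⟩ hp).2

/-- An open interval inside the sublevel lies in its interior; this is where the hypothesis
`interior_H` enters. -/
theorem H_lt_of_mem {p : ℝ} (h : 𝓗.LevelNonempty a e) (hs : s ∈ Icc (0 : ℝ) 1)
    (hp : p ∈ Ioo (𝓗.sigmaMinus a e s) (𝓗.sigmaPlus a e s)) : 𝓗.H e s p < a := by
  have : p ∈ interior {p | 𝓗.H e s p ≤ a} :=
    interior_maximal (fun q hq => H_le_of_mem h hs ⟨hq.1.le, hq.2.le⟩) isOpen_Ioo hp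
  rwa [𝓗.interior_H e s hs a] at this

theorem sigmaMinus_lt_sigmaPlus {p : ℝ} (hs : s ∈ Icc (0 : ℝ) 1) (hp : 𝓗.H e s p < a) :
    𝓗.sigmaMinus a e s < 𝓗.sigmaPlus a e s := by
  have hev : ∀ᶠ q in 𝓝 p, 𝓗.H e s q < a :=
    (continuous_slice hs).continuousAt.eventually_lt_const hp
  obtain ⟨l, u, ⟨hl, hu⟩, hsub⟩ := mem_nhds_iff_exists_Ioo_subset.1 hev
  have h1 := le_sigmaPlus hs (hsub ⟨hl.trans (show p < (p + u) / 2 by linarith), by linarith⟩ :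
    𝓗.H e s ((p + u) / 2) < a).le
  have h2 := sigmaMinus_le hs hp.le
  linarith

theorem sigmaMinus_eq_sigmaPlus (h : 𝓗.LevelNonempty a e) (hs : s ∈ Icc (0 : ℝ) 1)
    (hmin : ∀ p, a ≤ 𝓗.H e s p) : 𝓗.sigmaMinus a e s = 𝓗.sigmaPlus a e s := by
  refine (sigmaMinus_le_sigmaPlus h hs).antisymm ?_
  by_contra! hlt
  obtain ⟨p, hp⟩ := exists_between hlt
  exact absurd (H_lt_of_mem h hs hp) (not_lt.2 (hmin p))

theorem lt_H_of_sigmaPlus_lt {q : ℝ} (hs : s ∈ Icc (0 : ℝ) 1)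
    (hq : 𝓗.sigmaPlus a e s < q) : a < 𝓗.H e s q := by
  by_contra! hle
  exact absurd (le_sigmaPlus hs hle) (not_le.2 hq)

theorem sigmaPlus_lt_of_lt (h : 𝓗.LevelNonempty a e) (hs : s ∈ Icc (0 : ℝ) 1) (hab : a < b) :
    𝓗.sigmaPlus a e s < 𝓗.sigmaPlus b e s := by
  refine (le_sigmaPlus hs ((H_sigmaPlus h hs).le.trans hab.le)).lt_of_ne fun heq => ?_
  have h1 := H_sigmaPlus h hs
  rw [heq, H_sigmaPlus (h.mono hab.le) hs] at h1
  exact hab.ne' h1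

theorem sigmaPlus_mono (h : 𝓗.LevelNonempty a e) (hs : s ∈ Icc (0 : ℝ) 1) (hab : a ≤ b) :
    𝓗.sigmaPlus a e s ≤ 𝓗.sigmaPlus b e s :=
  le_sigmaPlus hs ((H_sigmaPlus h hs).le.trans hab)

/-- Coercivity is not assumed uniform in `s`; quasiconvexity replaces uniformity. For `t` near `s`,
an intermediate level is exceeded at `q` but not at the old endpoint to the left of `q`, so the
sublevel stays to the left of `q`. -/
theorem eventually_sigmaPlus_lt (h : 𝓗.LevelNonempty a e) (hs : s ∈ Icc (0 : ℝ) 1) {q : ℝ}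
    (hq : 𝓗.sigmaPlus a e s < q) : ∀ᶠ t in 𝓝[Icc 0 1] s, 𝓗.sigmaPlus a e t < q := by
  obtain ⟨b, hab, hbq⟩ := exists_between (lt_H_of_sigmaPlus_lt hs hq)
  filter_upwards [eventually_lt_slice hs hbq, self_mem_nhdsWithin,
    eventually_slice_lt hs ((H_sigmaPlus h hs).trans_lt hab)] with t h1 ht h2
  exact (𝓗.quasiconvex_H e t ht).lt_of_level_lt hq h2.le h1 ((H_sigmaPlus h ht).le.trans hab.le)

theorem continuousOn_sigmaPlus (h : 𝓗.LevelNonempty a e) :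
    ContinuousOn (𝓗.sigmaPlus a e) (Icc 0 1) := by
  intro s hs
  refine tendsto_order.2 ⟨fun q hq => ?_, fun q hq => eventually_sigmaPlus_lt h hs hq⟩
  by_cases hmin : ∃ p, 𝓗.H e s p < a
  · obtain ⟨p0, hp0⟩ := hmin
    obtain ⟨p, hp1, hp2⟩ := exists_between (max_lt hq (sigmaMinus_lt_sigmaPlus hs hp0))
    have hp := H_lt_of_mem h hs ⟨(le_max_right _ _).trans_lt hp1, hp2⟩
    filter_upwards [eventually_slice_lt hs hp, self_mem_nhdsWithin] with t h1 ht
    exact ((le_max_left _ _).trans_lt hp1).trans_le (le_sigmaPlus ht h1.le)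
  -- For a degenerate sublevel both endpoints agree, and upper semicontinuity on the reversed arc
  -- bounds `sigmaMinus`, hence `sigmaPlus`, from below.
  · push Not at hmin
    have heq := sigmaMinus_eq_sigmaPlus h hs hmin
    have hlt : 𝓗.sigmaPlus a (Γ.rev e) (1 - s) < -q := by unfold sigmaMinus at heq; linarith
    have hev := eventually_sigmaPlus_lt h.rev (one_sub_mem hs) hlt
    have htend : Tendsto (fun t : ℝ => 1 - t) (𝓝[Icc 0 1] s) (𝓝[Icc 0 1] (1 - s)) :=
      tendsto_nhdsWithin_iff.2 ⟨((continuous_const.sub continuous_id).tendsto s).mono_left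
        nhdsWithin_le_nhds, eventually_mem_nhdsWithin.mono fun t ht => one_sub_mem ht⟩
    filter_upwards [htend.eventually hev, self_mem_nhdsWithin] with t h1 ht
    have := sigmaMinus_le_sigmaPlus h ht
    unfold sigmaMinus at this; linarith

theorem continuousOn_sigmaPlus_level (h : 𝓗.LevelNonempty a e) (hs : s ∈ Icc (0 : ℝ) 1) :
    ContinuousOn (fun b => 𝓗.sigmaPlus b e s) (Ici a) := by
  intro b hb
  refine tendsto_order.2 ⟨fun q hq => ?_, fun q hq => ?_⟩
  · rcases eq_or_lt_of_le (show a ≤ b from hb) with rfl | hlt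
    · filter_upwards [self_mem_nhdsWithin] with c hc
      exact hq.trans_le (sigmaPlus_mono h hs hc)
    · obtain ⟨p0, hp0⟩ := h s hs
      obtain ⟨p, hp1, hp2⟩ :=
        exists_between (max_lt hq (sigmaMinus_lt_sigmaPlus hs (hp0.trans_lt hlt)))
      have hp := H_lt_of_mem (h.mono hlt.le) hs ⟨(le_max_right _ _).trans_lt hp1, hp2⟩
      filter_upwards [nhdsWithin_le_nhds (lt_mem_nhds hp)] with c hc
      exact ((le_max_left _ _).trans_lt hp1).trans_le (le_sigmaPlus hs (le_of_lt hc))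
  · have hlt := lt_H_of_sigmaPlus_lt hs hq
    obtain ⟨c0, hc0, hc1⟩ := exists_between hlt
    filter_upwards [nhdsWithin_le_nhds (gt_mem_nhds hc0), self_mem_nhdsWithin] with c hc hac
    refine (𝓗.quasiconvex_H e s hs).lt_of_level_lt (b := c0) hq ?_ hc1 ?_
    · rw [H_sigmaPlus (h.mono hb) hs]; exact hc0.le
    · rw [H_sigmaPlus (h.mono hac) hs]; exact le_of_lt hc

end NetworkHamiltonian

namespace NetworkHamiltonian

variable {N : ℕ} {E : Type*} {Γ : EmbeddedNetwork N E} {𝓗 : NetworkHamiltonian Γ}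
  {a b : ℝ} {e : E} {s t r : ℝ}

/-! ### Primitives of `σ_a⁺` and `σ_a⁻` -/

theorem projIcc_one_sub (t : ℝ) : (projIcc (0 : ℝ) 1 zero_le_one (1 - t) : ℝ) =
    1 - projIcc (0 : ℝ) 1 zero_le_one t := by
  simp only [coe_projIcc]
  rcases le_total t 0 with h | h
  · rw [min_eq_left (by linarith), min_eq_right (by linarith), max_eq_right zero_le_one,
      max_eq_left h]; ring
  · rcases le_total t 1 with h' | h'
    · rw [min_eq_right (by linarith), min_eq_right h', max_eq_right (by linarith),
        max_eq_right h]
    · rw [min_eq_right (by linarith), min_eq_left h', max_eq_left (by linarith),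
        max_eq_right zero_le_one]; ring

variable (𝓗) in
/-- The primitive of `σ_a⁺`, extended constantly outside `[0,1]`. -/
noncomputable def prim (a : ℝ) (e : E) (t : ℝ) : ℝ :=
  ∫ x in (0 : ℝ)..t, 𝓗.sigmaPlus a e (projIcc 0 1 zero_le_one x)

variable (𝓗) in
/-- A primitive of `σ_a⁻`. -/
noncomputable def primMinus (a : ℝ) (e : E) (t : ℝ) : ℝ := 𝓗.prim a (Γ.rev e) (1 - t)

theorem continuous_sigmaPlus_proj (h : 𝓗.LevelNonempty a e) :
    Continuous fun x : ℝ => 𝓗.sigmaPlus a e (projIcc 0 1 zero_le_one x) :=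
  (continuousOn_sigmaPlus h).comp_continuous (by fun_prop) fun x => (projIcc _ _ _ x).2

theorem hasDerivAt_prim (h : 𝓗.LevelNonempty a e) (t : ℝ) :
    HasDerivAt (𝓗.prim a e) (𝓗.sigmaPlus a e (projIcc 0 1 zero_le_one t)) t :=
  intervalIntegral.integral_hasDerivAt_right
    ((continuous_sigmaPlus_proj h).intervalIntegrable _ _)
    (continuous_sigmaPlus_proj h).aestronglyMeasurable.stronglyMeasurableAtFilter
    (continuous_sigmaPlus_proj h).continuousAt

theorem hasDerivAt_primMinus (h : 𝓗.LevelNonempty a e) (t : ℝ) :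
    HasDerivAt (𝓗.primMinus a e) (𝓗.sigmaMinus a e (projIcc 0 1 zero_le_one t)) t := by
  have := (hasDerivAt_prim h.rev (1 - t)).comp_const_sub 1 t
  rwa [projIcc_one_sub] at this

theorem hasDerivAt_prim_of_mem (h : 𝓗.LevelNonempty a e) (ht : t ∈ Icc (0 : ℝ) 1) :
    HasDerivAt (𝓗.prim a e) (𝓗.sigmaPlus a e t) t := by
  have := hasDerivAt_prim h t
  rwa [projIcc_of_mem _ ht] at this

theorem hasDerivAt_primMinus_of_mem (h : 𝓗.LevelNonempty a e) (ht : t ∈ Icc (0 : ℝ) 1) :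
    HasDerivAt (𝓗.primMinus a e) (𝓗.sigmaMinus a e t) t := by
  have := hasDerivAt_primMinus h t
  rwa [projIcc_of_mem _ ht] at this

/-- Extending the integrand constantly makes the primitive `C¹` on the whole line, as the test
functions are required to be. -/
theorem contDiff_prim (h : 𝓗.LevelNonempty a e) : ContDiff ℝ 1 (𝓗.prim a e) := by
  rw [contDiff_one_iff_deriv]
  refine ⟨fun t => (hasDerivAt_prim h t).differentiableAt, ?_⟩
  have : deriv (𝓗.prim a e) = _ := funext fun t => (hasDerivAt_prim h t).deriv
  rw [this]
  exact continuous_sigmaPlus_proj h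

theorem contDiff_primMinus (h : 𝓗.LevelNonempty a e) : ContDiff ℝ 1 (𝓗.primMinus a e) :=
  (contDiff_prim h.rev).comp (contDiff_const.sub contDiff_id)

theorem continuous_prim (h : 𝓗.LevelNonempty a e) : Continuous (𝓗.prim a e) :=
  (contDiff_prim h).continuous

theorem continuous_primMinus (h : 𝓗.LevelNonempty a e) : Continuous (𝓗.primMinus a e) :=
  (contDiff_primMinus h).continuous

theorem primMinus_rev : 𝓗.primMinus a (Γ.rev e) t = 𝓗.prim a e (1 - t) := by
  rw [primMinus, Γ.rev_rev]

theorem integral_sigmaPlus_eq (h : 𝓗.LevelNonempty a e) (h0 : 0 ≤ s) (hst : s ≤ t)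
    (h1 : t ≤ 1) : ∫ x in s..t, 𝓗.sigmaPlus a e x = 𝓗.prim a e t - 𝓗.prim a e s := by
  unfold prim
  rw [intervalIntegral.integral_interval_sub_left
    ((continuous_sigmaPlus_proj h).intervalIntegrable _ _)
    ((continuous_sigmaPlus_proj h).intervalIntegrable _ _)]
  refine intervalIntegral.integral_congr fun x hx => ?_
  rw [uIcc_of_le hst] at hx
  rw [projIcc_of_mem _ ⟨h0.trans hx.1, hx.2.trans h1⟩]

theorem portionLength_eq (h : 𝓗.LevelNonempty a e) (h0 : 0 ≤ s) (hst : s ≤ t) (h1 : t ≤ 1) :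
    𝓗.portionLength a ⟨e, s, t, h0, hst, h1⟩ = 𝓗.prim a e t - 𝓗.prim a e s :=
  integral_sigmaPlus_eq h h0 hst h1

theorem sigma_eq (h : 𝓗.LevelNonempty a e) : 𝓗.sigma a e = 𝓗.prim a e 1 - 𝓗.prim a e 0 :=
  integral_sigmaPlus_eq h le_rfl zero_le_one le_rfl

theorem monotone_prim_sub_primMinus (h : 𝓗.LevelNonempty a e) :
    Monotone fun t => 𝓗.prim a e t - 𝓗.primMinus a e t := by
  have hd := fun t => (hasDerivAt_prim h t).sub (hasDerivAt_primMinus h t)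
  refine monotone_of_deriv_nonneg (fun t => (hd t).differentiableAt) fun t => ?_
  exact (sub_nonneg.2 (sigmaMinus_le_sigmaPlus h (projIcc _ _ _ t).2)).trans_eq (hd t).deriv.symm

theorem prim_sub_eq_primMinus_sub (h : 𝓗.LevelNonempty a e)
    (hmin : ∀ s ∈ Icc (0 : ℝ) 1, ∀ p, a ≤ 𝓗.H e s p) (s t : ℝ) :
    𝓗.prim a e t - 𝓗.prim a e s = 𝓗.primMinus a e t - 𝓗.primMinus a e s := by
  have hd := fun t => (hasDerivAt_prim h t).sub (hasDerivAt_primMinus h t)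
  have := is_const_of_deriv_eq_zero (fun t => (hd t).differentiableAt) (fun t => by
    rw [(hd t).deriv, sub_eq_zero, sigmaMinus_eq_sigmaPlus h (projIcc _ _ _ t).2
      (hmin _ (projIcc _ _ _ t).2)]) t s
  simp only [Pi.sub_apply] at this
  linarith

variable (𝓗) in
/-- The intrinsic distance from `s` to `t` along an arc. -/
noncomputable def arcDist (a : ℝ) (e : E) (s t : ℝ) : ℝ :=
  max (𝓗.prim a e t - 𝓗.prim a e s) (𝓗.primMinus a e t - 𝓗.primMinus a e s)

theorem arcDist_self : 𝓗.arcDist a e s s = 0 := by simp [arcDist]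

theorem arcDist_triangle : 𝓗.arcDist a e s t ≤ 𝓗.arcDist a e s r + 𝓗.arcDist a e r t := by
  unfold arcDist
  refine max_le ?_ ?_
  · have h1 := le_max_left (𝓗.prim a e r - 𝓗.prim a e s)
      (𝓗.primMinus a e r - 𝓗.primMinus a e s)
    have h2 := le_max_left (𝓗.prim a e t - 𝓗.prim a e r)
      (𝓗.primMinus a e t - 𝓗.primMinus a e r)
    linarith
  · have h1 := le_max_right (𝓗.prim a e r - 𝓗.prim a e s)
      (𝓗.primMinus a e r - 𝓗.primMinus a e s)
    have h2 := le_max_right (𝓗.prim a e t - 𝓗.prim a e r)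
      (𝓗.primMinus a e t - 𝓗.primMinus a e r)
    linarith

/-- The difference of the primitives is nondecreasing, so the direction of travel selects the entry
of the maximum. Writing the distance as a maximum makes its triangle inequality and continuity
immediate. -/
theorem arcDist_of_le (h : 𝓗.LevelNonempty a e) (hst : s ≤ t) :
    𝓗.arcDist a e s t = 𝓗.prim a e t - 𝓗.prim a e s := by
  have := monotone_prim_sub_primMinus h hst
  exact max_eq_left (by simp only at this; linarith)

theorem arcDist_of_ge (h : 𝓗.LevelNonempty a e) (hts : t ≤ s) :
    𝓗.arcDist a e s t = 𝓗.primMinus a e t - 𝓗.primMinus a e s := by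
  have := monotone_prim_sub_primMinus h hts
  exact max_eq_right (by simp only at this; linarith)

theorem arcDist_rev : 𝓗.arcDist a (Γ.rev e) (1 - s) (1 - t) = 𝓗.arcDist a e s t := by
  unfold arcDist
  rw [primMinus_rev, primMinus_rev, max_comm]
  simp [primMinus]

theorem continuous_arcDist_left (h : 𝓗.LevelNonempty a e) (t : ℝ) :
    Continuous fun s => 𝓗.arcDist a e s t := by
  have := continuous_prim h
  have := continuous_primMinus h
  unfold arcDist; fun_prop

theorem continuous_arcDist_right (h : 𝓗.LevelNonempty a e) (s : ℝ) :
    Continuous fun t => 𝓗.arcDist a e s t := by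
  have := continuous_prim h
  have := continuous_primMinus h
  unfold arcDist; fun_prop

end NetworkHamiltonian

/-! ### Geometry of the network -/

namespace EmbeddedNetwork

variable {N : ℕ} {E : Type*} (Γ : EmbeddedNetwork N E) {e d : E} {s t r : ℝ}
  {x y z : EuclideanSpace ℝ (Fin N)}

theorem arc_rev' (hs : s ∈ Icc (0 : ℝ) 1) : Γ.arc (Γ.rev e) (1 - s) = Γ.arc e s := by
  rw [Γ.arc_rev _ _ ⟨by linarith [hs.2], by linarith [hs.1]⟩]; simp

theorem arc_rev_zero : Γ.arc (Γ.rev e) 0 = Γ.arc e 1 := by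
  rw [Γ.arc_rev _ _ ⟨le_rfl, zero_le_one⟩]; simp

theorem arc_rev_one : Γ.arc (Γ.rev e) 1 = Γ.arc e 0 := by
  rw [Γ.arc_rev _ _ ⟨zero_le_one, le_rfl⟩]; simp

theorem continuousOn_arc (e : E) : ContinuousOn (Γ.arc e) (Icc 0 1) :=
  (Γ.contDiffOn_arc e).continuousOn

theorem arc_mem_support (hs : s ∈ Icc (0 : ℝ) 1) : Γ.arc e s ∈ Γ.support :=
  mem_iUnion.2 ⟨e, s, hs, rfl⟩

theorem arc_zero_mem_vertices (e : E) : Γ.arc e 0 ∈ Γ.vertices := ⟨e, Or.inl rfl⟩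

theorem arc_one_mem_vertices (e : E) : Γ.arc e 1 ∈ Γ.vertices := ⟨e, Or.inr rfl⟩

theorem exists_arc_zero_eq (hx : x ∈ Γ.vertices) : ∃ e, Γ.arc e 0 = x := by
  obtain ⟨e, h | h⟩ := hx
  · exact ⟨e, h⟩
  · exact ⟨Γ.rev e, by rw [arc_rev_zero, h]⟩

theorem vertices_subset_support : Γ.vertices ⊆ Γ.support := by
  rintro x ⟨e, rfl | rfl⟩
  · exact Γ.arc_mem_support ⟨le_rfl, zero_le_one⟩
  · exact Γ.arc_mem_support ⟨zero_le_one, le_rfl⟩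

theorem finite_vertices [Finite E] : Γ.vertices.Finite := by
  have : Γ.vertices = range (fun e => Γ.arc e 0) := by
    ext x
    exact ⟨fun h => Γ.exists_arc_zero_eq h, fun ⟨e, h⟩ => ⟨e, Or.inl h⟩⟩
  rw [this]
  exact finite_range _

theorem arc_notMem_vertices (hs : s ∈ Ioo (0 : ℝ) 1) : Γ.arc e s ∉ Γ.vertices := by
  rintro ⟨d, h | h⟩
  · exact (Γ.interior_ne_vertex e d s hs).1 h.symm
  · exact (Γ.interior_ne_vertex e d s hs).2 h.symm

theorem mem_Ioo_of_notMem_vertices (hs : s ∈ Icc (0 : ℝ) 1) (h : Γ.arc e s ∉ Γ.vertices) :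
    s ∈ Ioo (0 : ℝ) 1 := by
  refine ⟨hs.1.lt_of_ne ?_, hs.2.lt_of_ne ?_⟩
  · rintro rfl; exact h (Γ.arc_zero_mem_vertices e)
  · rintro rfl; exact h (Γ.arc_one_mem_vertices e)

theorem eq_zero_or_one_of_mem_vertices (hs : s ∈ Icc (0 : ℝ) 1) (h : Γ.arc e s ∈ Γ.vertices) :
    s = 0 ∨ s = 1 := by
  by_contra! hne
  exact Γ.arc_notMem_vertices ⟨hs.1.lt_of_ne hne.1.symm, hs.2.lt_of_ne hne.2⟩ h

/-- A point that is not a vertex is parametrized by one arc and its inverse only. -/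
theorem eq_or_eq_rev_of_arc_eq (hs : s ∈ Icc (0 : ℝ) 1) (hr : r ∈ Icc (0 : ℝ) 1)
    (hx : Γ.arc e s ∉ Γ.vertices) (h : Γ.arc d r = Γ.arc e s) :
    (d = e ∧ r = s) ∨ (d = Γ.rev e ∧ r = 1 - s) := by
  have hs' := Γ.mem_Ioo_of_notMem_vertices hs hx
  have hr' := Γ.mem_Ioo_of_notMem_vertices hr (h ▸ hx)
  have inj : ∀ t ∈ Ioo (0 : ℝ) 1, Γ.arc e t = Γ.arc e s → t = s := by
    intro t ht hts
    rcases lt_trichotomy t s with hlt | heq | hlt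
    · exact absurd (Γ.simple_arc e t ⟨ht.1.le, ht.2.le⟩ s hs hlt hts).1 ht.1.ne'
    · exact heq
    · exact absurd (Γ.simple_arc e s hs t ⟨ht.1.le, ht.2.le⟩ hlt hts.symm).1 hs'.1.ne'
  by_cases hde : d = e
  · subst hde
    exact Or.inl ⟨rfl, inj r hr' h⟩
  by_cases hde' : d = Γ.rev e
  · subst hde'
    rw [Γ.arc_rev _ _ hr] at h
    refine Or.inr ⟨rfl, ?_⟩
    have := inj (1 - r) ⟨by linarith [hr'.2], by linarith [hr'.1]⟩ h
    linarith
  · exact absurd (Γ.disjoint_arc d e hde hde')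
      (not_disjoint_iff.2 ⟨_, ⟨r, hr', h⟩, ⟨s, hs', rfl⟩⟩)

theorem isCompact_support [Finite E] : IsCompact Γ.support :=
  isCompact_iUnion fun e => isCompact_Icc.image_of_continuousOn (Γ.continuousOn_arc e)

/-- The preimage of a closed set is a finite union of continuous images of compact parameter sets,
hence closed. -/
theorem continuousOn_of_comp_arc [Finite E] {u : EuclideanSpace ℝ (Fin N) → ℝ}
    (h : ∀ e, ContinuousOn (fun t => u (Γ.arc e t)) (Icc 0 1)) : ContinuousOn u Γ.support := by
  rw [continuousOn_iff_isClosed]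
  intro C hC
  refine ⟨⋃ e, Γ.arc e '' (Icc 0 1 ∩ (fun t => u (Γ.arc e t)) ⁻¹' C), ?_, ?_⟩
  · refine isClosed_iUnion_of_finite fun e => ?_
    have hcl : IsClosed (Icc (0 : ℝ) 1 ∩ (fun t => u (Γ.arc e t)) ⁻¹' C) :=
      (h e).preimage_isClosed_of_isClosed isClosed_Icc hC
    exact ((isCompact_Icc.of_isClosed_subset hcl inter_subset_left).image_of_continuousOn
      ((Γ.continuousOn_arc e).mono inter_subset_left)).isClosed
  · ext x
    simp only [mem_inter_iff, mem_preimage, mem_iUnion, mem_image]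
    constructor
    · rintro ⟨hx, hs⟩
      obtain ⟨e, t, ht, rfl⟩ := mem_iUnion.1 hs
      exact ⟨⟨e, t, ⟨ht, hx⟩, rfl⟩, hs⟩
    · rintro ⟨⟨e, t, ⟨ht, htC⟩, rfl⟩, hs⟩
      exact ⟨htC, hs⟩

theorem continuousOn_comp_arc {u : EuclideanSpace ℝ (Fin N) → ℝ} (h : ContinuousOn u Γ.support)
    (e : E) : ContinuousOn (fun t => u (Γ.arc e t)) (Icc 0 1) :=
  h.comp (Γ.continuousOn_arc e) fun _ ht => Γ.arc_mem_support ht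

theorem isCurve_append {ξ η : List (ArcPortion E)} :
    Γ.IsCurve (ξ ++ η) x z ↔ ∃ y, Γ.IsCurve ξ x y ∧ Γ.IsCurve η y z := by
  induction ξ generalizing x with
  | nil => simp [IsCurve]
  | cons p ξ ih => simp [IsCurve, ih, and_assoc]

theorem isCurve_singleton (hs : 0 ≤ s) (hst : s ≤ t) (ht : t ≤ 1) :
    Γ.IsCurve [⟨e, s, t, hs, hst, ht⟩] (Γ.arc e s) (Γ.arc e t) := ⟨rfl, rfl⟩

theorem exists_isCurve (hx : x ∈ Γ.support) (hy : y ∈ Γ.support) : ∃ ξ, Γ.IsCurve ξ x y := by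
  obtain ⟨e, s, hs, rfl⟩ := mem_iUnion.1 hx
  obtain ⟨d, t, ht, rfl⟩ := mem_iUnion.1 hy
  have h1 := Γ.isCurve_singleton (e := e) hs.1 hs.2 le_rfl
  have h3 := Γ.isCurve_singleton (e := d) le_rfl ht.1 ht.2
  obtain ⟨ξ, hξ⟩ : ∃ ξ, Γ.IsCurve ξ (Γ.arc e 1) (Γ.arc d 0) := by
    -- `connected` speaks of initial points only, so the terminal point of `e` is read as the
    -- initial point of the reversed arc.
    rw [← Γ.arc_rev_zero]
    have hc := Γ.connected (Γ.rev e) d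
    generalize Γ.arc d 0 = z at hc
    induction hc with
    | refl => exact ⟨[], rfl⟩
    | tail _ hstep ih =>
      obtain ⟨ξ, hξ⟩ := ih
      obtain ⟨c, rfl, rfl⟩ := hstep
      exact ⟨ξ ++ _, Γ.isCurve_append.2
        ⟨_, hξ, Γ.isCurve_singleton (e := c) le_rfl zero_le_one le_rfl⟩⟩
  exact ⟨_, Γ.isCurve_append.2 ⟨_, Γ.isCurve_append.2 ⟨_, h1, hξ⟩, h3⟩⟩

end EmbeddedNetwork

namespace NetworkHamiltonian

variable {N : ℕ} {E : Type*} {Γ : EmbeddedNetwork N E} {𝓗 : NetworkHamiltonian Γ}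
  {a b : ℝ} {e : E} {s t r : ℝ} {x y z : EuclideanSpace ℝ (Fin N)}
  {f : EuclideanSpace ℝ (Fin N) → ℝ}

/-! ### Subsolutions in integral form and the semidistance -/

variable (𝓗) in
/-- Subsolutions of `𝓗(x, Du) = a` in integral form. -/
def IsSub (a : ℝ) (f : EuclideanSpace ℝ (Fin N) → ℝ) : Prop :=
  ∀ e s t, 0 ≤ s → s ≤ t → t ≤ 1 →
    f (Γ.arc e t) - f (Γ.arc e s) ≤ 𝓗.prim a e t - 𝓗.prim a e s

/-- Backward travel on `e` is forward travel on `Γ.rev e`, which the quantifier over all arcs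
already covers. -/
theorem isSub_iff_arcDist (h : ∀ e, 𝓗.LevelNonempty a e) : 𝓗.IsSub a f ↔
    ∀ e, ∀ s ∈ Icc (0 : ℝ) 1, ∀ t ∈ Icc (0 : ℝ) 1,
      f (Γ.arc e t) - f (Γ.arc e s) ≤ 𝓗.arcDist a e s t := by
  constructor
  · intro hf e s hs t ht
    rcases le_total s t with hst | hst
    · exact (hf e s t hs.1 hst ht.2).trans (le_max_left _ _)
    · have := hf (Γ.rev e) (1 - s) (1 - t) (by linarith [hs.2]) (by linarith)
        (by linarith [ht.1])
      rw [Γ.arc_rev' hs, Γ.arc_rev' ht] at this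
      exact this.trans (le_max_right _ _)
  · intro hf e s t hs hst ht
    rw [← arcDist_of_le (h e) hst]
    exact hf e s ⟨hs, hst.trans ht⟩ t ⟨hs.trans hst, ht⟩

theorem IsSub.le_arcDist (hf : 𝓗.IsSub a f) (h : ∀ e, 𝓗.LevelNonempty a e)
    (hs : s ∈ Icc (0 : ℝ) 1) (ht : t ∈ Icc (0 : ℝ) 1) :
    f (Γ.arc e t) - f (Γ.arc e s) ≤ 𝓗.arcDist a e s t :=
  (isSub_iff_arcDist h).1 hf e s hs t ht

theorem IsSub.continuousOn_comp_arc (hf : 𝓗.IsSub a f) (h : ∀ e, 𝓗.LevelNonempty a e) (e : E) :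
    ContinuousOn (fun t => f (Γ.arc e t)) (Icc 0 1) := by
  intro s hs
  have h1 : Tendsto (fun t => f (Γ.arc e s) + 𝓗.arcDist a e s t) (𝓝[Icc 0 1] s)
      (𝓝 (f (Γ.arc e s))) := by
    have := ((continuous_arcDist_right (h e) s).tendsto s).const_add (f (Γ.arc e s))
    rw [arcDist_self, add_zero] at this
    exact this.mono_left nhdsWithin_le_nhds
  have h2 : Tendsto (fun t => f (Γ.arc e s) - 𝓗.arcDist a e t s) (𝓝[Icc 0 1] s)
      (𝓝 (f (Γ.arc e s))) := by
    have := ((continuous_arcDist_left (h e) s).tendsto s).const_sub (f (Γ.arc e s))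
    rw [arcDist_self, sub_zero] at this
    exact this.mono_left nhdsWithin_le_nhds
  refine tendsto_of_tendsto_of_tendsto_of_le_of_le' h2 h1 ?_ ?_
  · filter_upwards [self_mem_nhdsWithin] with t ht
    linarith [hf.le_arcDist h ht hs (e := e)]
  · filter_upwards [self_mem_nhdsWithin] with t ht
    linarith [hf.le_arcDist h hs ht (e := e)]

theorem IsSub.continuousOn [Finite E] (hf : 𝓗.IsSub a f) (h : ∀ e, 𝓗.LevelNonempty a e) :
    ContinuousOn f Γ.support :=
  Γ.continuousOn_of_comp_arc (hf.continuousOn_comp_arc h)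

theorem curveLength_append (ξ η : List (ArcPortion E)) :
    𝓗.curveLength a (ξ ++ η) = 𝓗.curveLength a ξ + 𝓗.curveLength a η := by
  simp [curveLength]

theorem IsSub.le_curveLength (hf : 𝓗.IsSub a f) (h : ∀ e, 𝓗.LevelNonempty a e)
    {ξ : List (ArcPortion E)} (hξ : Γ.IsCurve ξ x y) : f y - f x ≤ 𝓗.curveLength a ξ := by
  induction ξ generalizing x with
  | nil =>
    have : x = y := hξ
    subst this
    simp [curveLength]
  | cons p ξ ih =>
    obtain ⟨rfl, h2⟩ := hξ
    have h3 := ih h2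
    have h4 := hf p.edge p.s₁ p.s₂ p.zero_le p.le p.le_one
    have h5 : 𝓗.curveLength a (p :: ξ) = 𝓗.portionLength a p + 𝓗.curveLength a ξ := by
      simp [curveLength]
    have h6 := portionLength_eq (h p.edge) p.zero_le p.le p.le_one
    rw [h5, h6]
    linarith

variable (𝓗) in
/-- Closed curves have non-negative intrinsic length. -/
def ClosedCurvesNonneg (a : ℝ) : Prop :=
  ∀ ξ x, Γ.IsCurve ξ x x → 0 ≤ 𝓗.curveLength a ξ

theorem IsSub.closedCurvesNonneg (hf : 𝓗.IsSub a f) (h : ∀ e, 𝓗.LevelNonempty a e) :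
    𝓗.ClosedCurvesNonneg a := fun ξ x hξ => by
  simpa using hf.le_curveLength h hξ

/-- A fixed return curve closes up every competitor. Without this bound the `sInf` in `semidistance`
would not be meaningful. -/
theorem ClosedCurvesNonneg.bddBelow (hn : 𝓗.ClosedCurvesNonneg a) (hx : x ∈ Γ.support)
    (hy : y ∈ Γ.support) : BddBelow {l | ∃ ξ, Γ.IsCurve ξ x y ∧ 𝓗.curveLength a ξ = l} := by
  obtain ⟨η, hη⟩ := Γ.exists_isCurve hy hx
  refine ⟨-𝓗.curveLength a η, ?_⟩
  rintro l ⟨ξ, hξ, rfl⟩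
  have := hn (ξ ++ η) x (Γ.isCurve_append.2 ⟨y, hξ, hη⟩)
  rw [curveLength_append] at this
  linarith

theorem ClosedCurvesNonneg.semidistance_le (hn : 𝓗.ClosedCurvesNonneg a) (hx : x ∈ Γ.support)
    (hy : y ∈ Γ.support) {ξ : List (ArcPortion E)} (hξ : Γ.IsCurve ξ x y) :
    𝓗.semidistance a x y ≤ 𝓗.curveLength a ξ :=
  csInf_le (hn.bddBelow hx hy) ⟨ξ, hξ, rfl⟩

theorem le_semidistance (hx : x ∈ Γ.support) (hy : y ∈ Γ.support) {l : ℝ}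
    (hl : ∀ ξ, Γ.IsCurve ξ x y → l ≤ 𝓗.curveLength a ξ) : l ≤ 𝓗.semidistance a x y := by
  obtain ⟨ξ, hξ⟩ := Γ.exists_isCurve hx hy
  refine le_csInf ⟨_, ξ, hξ, rfl⟩ ?_
  rintro _ ⟨η, hη, rfl⟩
  exact hl η hη

theorem ClosedCurvesNonneg.semidistance_self (hn : 𝓗.ClosedCurvesNonneg a)
    (hx : x ∈ Γ.support) : 𝓗.semidistance a x x = 0 := by
  refine le_antisymm ?_ (le_semidistance hx hx fun ξ hξ => hn ξ x hξ)
  have := hn.semidistance_le hx hx (ξ := []) rfl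
  simpa [curveLength] using this

theorem ClosedCurvesNonneg.semidistance_triangle (hn : 𝓗.ClosedCurvesNonneg a)
    (hx : x ∈ Γ.support) (hy : y ∈ Γ.support) (hz : z ∈ Γ.support) :
    𝓗.semidistance a x z ≤ 𝓗.semidistance a x y + 𝓗.semidistance a y z := by
  rw [← sub_le_iff_le_add']
  refine le_semidistance hy hz fun η hη => ?_
  rw [sub_le_iff_le_add', ← sub_le_iff_le_add]
  refine le_semidistance hx hy fun ξ hξ => ?_
  have := hn.semidistance_le hx hz (Γ.isCurve_append.2 ⟨y, hξ, hη⟩)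
  rw [curveLength_append] at this
  linarith

theorem ClosedCurvesNonneg.semidistance_arc_le (hn : 𝓗.ClosedCurvesNonneg a)
    (h : ∀ e, 𝓗.LevelNonempty a e) (hs : 0 ≤ s) (hst : s ≤ t) (ht : t ≤ 1) :
    𝓗.semidistance a (Γ.arc e s) (Γ.arc e t) ≤ 𝓗.prim a e t - 𝓗.prim a e s := by
  have := hn.semidistance_le (Γ.arc_mem_support ⟨hs, hst.trans ht⟩)
    (Γ.arc_mem_support ⟨hs.trans hst, ht⟩) (Γ.isCurve_singleton (e := e) hs hst ht)
  rw [← portionLength_eq (h e) hs hst ht]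
  simpa [curveLength] using this

theorem IsSub.le_semidistance (hf : 𝓗.IsSub a f) (h : ∀ e, 𝓗.LevelNonempty a e)
    (hx : x ∈ Γ.support) (hy : y ∈ Γ.support) : f y - f x ≤ 𝓗.semidistance a x y :=
  NetworkHamiltonian.le_semidistance hx hy fun _ hξ => hf.le_curveLength h hξ

theorem ClosedCurvesNonneg.isSub_semidistance (hn : 𝓗.ClosedCurvesNonneg a)
    (h : ∀ e, 𝓗.LevelNonempty a e) (hx : x ∈ Γ.support) : 𝓗.IsSub a (𝓗.semidistance a x) := by
  intro e s t hs hst ht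
  have h1 := hn.semidistance_triangle hx (Γ.arc_mem_support (e := e) ⟨hs, hst.trans ht⟩)
    (Γ.arc_mem_support (e := e) ⟨hs.trans hst, ht⟩)
  have h2 := hn.semidistance_arc_le h hs hst ht (e := e)
  linarith

theorem ClosedCurvesNonneg.isSub_neg_semidistance (hn : 𝓗.ClosedCurvesNonneg a)
    (h : ∀ e, 𝓗.LevelNonempty a e) (hy : y ∈ Γ.support) :
    𝓗.IsSub a (fun x => -𝓗.semidistance a x y) := by
  intro e s t hs hst ht
  have h1 := hn.semidistance_triangle (Γ.arc_mem_support (e := e) ⟨hs, hst.trans ht⟩)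
    (Γ.arc_mem_support (e := e) ⟨hs.trans hst, ht⟩) hy
  have h2 := hn.semidistance_arc_le h hs hst ht (e := e)
  linarith

end NetworkHamiltonian

/-! ### One-dimensional viscosity arguments -/

theorem HasDerivAt.nonneg_of_eventually_right {f : ℝ → ℝ} {f' s : ℝ} (h : HasDerivAt f f' s)
    (hf : ∀ᶠ t in 𝓝[>] s, f s ≤ f t) : 0 ≤ f' := by
  have := (hasDerivAt_iff_tendsto_slope.1 h).mono_left (nhdsGT_le_nhdsNE s)
  refine ge_of_tendsto this ?_
  filter_upwards [hf, self_mem_nhdsWithin] with t ht hst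
  rw [slope_def_field]
  exact div_nonneg (sub_nonneg.2 ht) (sub_nonneg.2 (le_of_lt hst))

theorem HasDerivAt.nonneg_of_eventually_left {f : ℝ → ℝ} {f' s : ℝ} (h : HasDerivAt f f' s)
    (hf : ∀ᶠ t in 𝓝[<] s, f t ≤ f s) : 0 ≤ f' := by
  have := (hasDerivAt_iff_tendsto_slope.1 h).mono_left (nhdsLT_le_nhdsNE s)
  refine ge_of_tendsto this ?_
  filter_upwards [hf, self_mem_nhdsWithin] with t ht hst
  rw [slope_def_field]
  exact div_nonneg_of_nonpos (sub_nonpos.2 ht) (sub_nonpos.2 (le_of_lt hst))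

namespace NetworkHamiltonian

variable {N : ℕ} {E : Type*} {Γ : EmbeddedNetwork N E} {𝓗 : NetworkHamiltonian Γ}
  {a b α β r s : ℝ} {e : E} {w : ℝ → ℝ} {f : EuclideanSpace ℝ (Fin N) → ℝ}

/-- If `w - prim` had a positive increment, subtracting a suitable increasing exponential would
leave an interior maximum. There a test function of slope greater than `sigmaPlus` touches `w` from
above, although `H > a` for such slopes. No regularity of `w` beyond continuity is needed. -/
theorem sub_le_prim_of_isViscSubAt (h : 𝓗.LevelNonempty a e) (hα : 0 ≤ α) (hαβ : α ≤ β)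
    (hβ : β ≤ 1) (hw : ContinuousOn w (Icc α β))
    (hsub : ∀ r ∈ Ioo α β, IsViscSubAt (𝓗.H e) a w r) :
    w β - w α ≤ 𝓗.prim a e β - 𝓗.prim a e α := by
  by_contra! hlt
  have hαβ' : α < β := hαβ.lt_of_ne (by rintro rfl; simp at hlt)
  set ψ : ℝ → ℝ := fun t => w t - 𝓗.prim a e t with hψ
  have hψc : ContinuousOn ψ (Icc α β) := hw.sub (continuous_prim h).continuousOn
  have hψlt : ψ α < ψ β := by simp only [hψ]; linarith
  obtain ⟨t, ht, htαβ⟩ : ∃ t, ψ α < ψ t ∧ t ∈ Ioo α β := by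
    have h1 : ∀ᶠ t in 𝓝[Ioo α β] β, ψ α < ψ t :=
      ((hψc β (right_mem_Icc.2 hαβ)).mono Ioo_subset_Icc_self).eventually_const_lt hψlt
    have : (𝓝[Ioo α β] β).NeBot := by
      rw [nhdsWithin_Ioo_eq_nhdsLT hαβ']; infer_instance
    exact (h1.and self_mem_nhdsWithin).exists
  set ε := ψ t - ψ α with hε
  have hε0 : 0 < ε := sub_pos.2 ht
  have hβt : 0 < β - t := sub_pos.2 htαβ.2
  -- With this rate, `1 + x ≤ exp x` gives `η β ≥ ε + (ψ β - ψ α)`. Thus `ψ - η` equals `ψ α` at `t`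
  -- and is smaller at both endpoints.
  set K := (ψ β - ψ α) / (ε * (β - t)) with hK
  have hK0 : 0 < K := div_pos (sub_pos.2 hψlt) (mul_pos hε0 hβt)
  set η : ℝ → ℝ := fun x => ε * Real.exp (K * (x - t)) with hη
  have hηd : ∀ x, HasDerivAt η (ε * (Real.exp (K * (x - t)) * (K * 1))) x := fun x =>
    ((((hasDerivAt_id x).sub_const t).const_mul K).exp).const_mul ε
  have hηc : ContDiff ℝ 1 η := by simp only [hη]; fun_prop
  obtain ⟨m, hm, hmax⟩ := isCompact_Icc.exists_isMaxOn (nonempty_Icc.2 hαβ)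
    (hψc.sub hηc.continuous.continuousOn)
  have hmt := hmax (⟨htαβ.1.le, htαβ.2.le⟩ : t ∈ Icc α β)
  simp only [mem_ofPred_eq, Pi.sub_apply] at hmt
  have hηt : η t = ε := by simp [hη]
  have hmα : m ≠ α := by
    rintro rfl
    have : 0 < η m := mul_pos hε0 (Real.exp_pos _)
    linarith
  have hmβ : m ≠ β := by
    rintro rfl
    have h1 := Real.add_one_le_exp (K * (m - t))
    have h2 : ε * (K * (m - t)) = ψ m - ψ α := by
      rw [hK]; field_simp
    have h3 : ε * (K * (m - t) + 1) ≤ η m := mul_le_mul_of_nonneg_left h1 hε0.le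
    linarith
  have hmI : m ∈ Ioo α β := ⟨hm.1.lt_of_ne hmα.symm, hm.2.lt_of_ne hmβ⟩
  have hm01 : m ∈ Icc (0 : ℝ) 1 := ⟨hα.trans hm.1, hm.2.trans hβ⟩
  have hd : HasDerivAt (fun x => 𝓗.prim a e x + η x + (ψ m - η m))
      (𝓗.sigmaPlus a e m + ε * (Real.exp (K * (m - t)) * (K * 1))) m :=
    ((hasDerivAt_prim_of_mem h hm01).add (hηd m)).add_const _
  have := hsub m hmI (fun x => 𝓗.prim a e x + η x + (ψ m - η m))
    (((contDiff_prim h).add hηc).add contDiff_const) (by simp [hψ]) (by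
      filter_upwards [Ioo_mem_nhds hmI.1 hmI.2] with x hx
      have := hmax (⟨hx.1.le, hx.2.le⟩ : x ∈ Icc α β)
      simp only [mem_ofPred_eq, Pi.sub_apply] at this
      simp only [hψ] at this ⊢
      linarith)
  rw [hd.deriv] at this
  have hpos : 0 < ε * (Real.exp (K * (m - t)) * (K * 1)) := by positivity
  exact absurd (le_sigmaPlus hm01 this) (by linarith)

/-- Travelling to `s` from its right bounds the slope of the test function below by `sigmaMinus`;
travelling to `s` from its left bounds it above by `sigmaPlus`. -/
theorem IsSub.isViscSubAt (hf : 𝓗.IsSub a f) (h : ∀ e, 𝓗.LevelNonempty a e)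
    (hs : s ∈ Ioo (0 : ℝ) 1) : IsViscSubAt (𝓗.H e) a (fun t => f (Γ.arc e t)) s := by
  intro φ hφ hφs hle
  have hs' : s ∈ Icc (0 : ℝ) 1 := Ioo_subset_Icc_self hs
  have hd : HasDerivAt φ (deriv φ s) s := (hφ.differentiable one_ne_zero s).hasDerivAt
  have hI : ∀ᶠ t in 𝓝 s, t ∈ Icc (0 : ℝ) 1 := Icc_mem_nhds hs.1 hs.2
  refine H_le_of_mem (h e) hs' ⟨?_, ?_⟩
  · have := (hd.sub (hasDerivAt_primMinus_of_mem (h e) hs')).nonneg_of_eventually_right (by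
      filter_upwards [nhdsWithin_le_nhds hle, nhdsWithin_le_nhds hI, self_mem_nhdsWithin]
        with t h1 h2 h3
      have := hf.le_arcDist h h2 hs' (e := e)
      rw [arcDist_of_ge (h e) (le_of_lt h3)] at this
      simp only [Pi.sub_apply]
      linarith)
    linarith
  · have := ((hasDerivAt_prim_of_mem (h e) hs').sub hd).nonneg_of_eventually_left (by
      filter_upwards [nhdsWithin_le_nhds hle, nhdsWithin_le_nhds hI, self_mem_nhdsWithin]
        with t h1 h2 h3
      have := hf.le_arcDist h h2 hs' (e := e)
      rw [arcDist_of_le (h e) (le_of_lt h3)] at this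
      simp only [Pi.sub_apply]
      linarith)
    linarith

/-- A `C¹` function of slope `sigmaPlus` touches `w` from above, so a test function from below must
have the same slope at `s`, where `H = a`. -/
theorem isViscSuperAt_of_le_prim (h : 𝓗.LevelNonempty a e) (hs : s ∈ Icc (0 : ℝ) 1)
    (hw : ∀ᶠ t in 𝓝 s, w t ≤ w s + (𝓗.prim a e t - 𝓗.prim a e s)) :
    IsViscSuperAt (𝓗.H e) a w s := by
  intro φ hφ hφs hle
  have hd : HasDerivAt φ (deriv φ s) s := (hφ.differentiable one_ne_zero s).hasDerivAt
  have hmax : IsLocalMax (φ - 𝓗.prim a e) s := by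
    filter_upwards [hw, hle] with t h1 h2
    simp only [Pi.sub_apply]; linarith
  have := hmax.hasDerivAt_eq_zero (hd.sub (hasDerivAt_prim_of_mem h hs))
  rw [sub_eq_zero.1 this, H_sigmaPlus h hs]

theorem isViscSuperAt_of_le_primMinus (h : 𝓗.LevelNonempty a e) (hs : s ∈ Icc (0 : ℝ) 1)
    (hw : ∀ᶠ t in 𝓝 s, w t ≤ w s + (𝓗.primMinus a e t - 𝓗.primMinus a e s)) :
    IsViscSuperAt (𝓗.H e) a w s := by
  intro φ hφ hφs hle
  have hd : HasDerivAt φ (deriv φ s) s := (hφ.differentiable one_ne_zero s).hasDerivAt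
  have hmax : IsLocalMax (φ - 𝓗.primMinus a e) s := by
    filter_upwards [hw, hle] with t h1 h2
    simp only [Pi.sub_apply]; linarith
  have := hmax.hasDerivAt_eq_zero (hd.sub (hasDerivAt_primMinus_of_mem h hs))
  rw [sub_eq_zero.1 this, H_sigmaMinus h hs]

/-- A one-sided touching only gives a slope at least `sigmaPlus`, which suffices since `H ≥ a` on
that side. -/
theorem stateConstraintAtOne_of_le_prim (h : 𝓗.LevelNonempty a e)
    (hw : ∀ᶠ t in 𝓝[<] 1, w t ≤ w 1 + (𝓗.prim a e t - 𝓗.prim a e 1)) :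
    StateConstraintAtOne (𝓗.H e) a w := by
  intro φ hφ hφs hle
  have h1 : (1 : ℝ) ∈ Icc (0 : ℝ) 1 := ⟨zero_le_one, le_rfl⟩
  have hd : HasDerivAt φ (deriv φ 1) 1 := (hφ.differentiable one_ne_zero 1).hasDerivAt
  have := (hd.sub (hasDerivAt_prim_of_mem h h1)).nonneg_of_eventually_left (by
    filter_upwards [hw, hle] with t h1 h2
    simp only [Pi.sub_apply]; linarith)
  rcases (sub_nonneg.1 this).eq_or_lt with heq | hlt
  · rw [← heq, H_sigmaPlus h h1]
  · exact (lt_H_of_sigmaPlus_lt h1 hlt).le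

/-- A strict subsolution of class `C¹` touches a supersolution from below only at the boundary. -/
theorem exists_endpoint_isMinOn (h : 𝓗.LevelNonempty a e) (hα : 0 ≤ α) (hαβ : α ≤ β)
    (hβ : β ≤ 1) (hw : ContinuousOn w (Icc α β))
    (hsup : ∀ r ∈ Ioo α β, IsViscSuperAt (𝓗.H e) a w r) {φ : ℝ → ℝ} (hφ : ContDiff ℝ 1 φ)
    (hφd : ∀ r ∈ Ioo α β, deriv φ r ∈ Ioo (𝓗.sigmaMinus a e r) (𝓗.sigmaPlus a e r)) :
    ∃ m, (m = α ∨ m = β) ∧ ∀ r ∈ Icc α β, w m - φ m ≤ w r - φ r := by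
  obtain ⟨m, hm, hmin⟩ := isCompact_Icc.exists_isMinOn (nonempty_Icc.2 hαβ)
    (hw.sub hφ.continuous.continuousOn)
  refine ⟨m, ?_, fun r hr => hmin hr⟩
  by_contra! hne
  have hmI : m ∈ Ioo α β := ⟨hm.1.lt_of_ne hne.1.symm, hm.2.lt_of_ne hne.2⟩
  have := hsup m hmI (fun x => φ x + (w m - φ m)) (hφ.add contDiff_const) (by ring) (by
    filter_upwards [Ioo_mem_nhds hmI.1 hmI.2] with x hx
    have := hmin (⟨hx.1.le, hx.2.le⟩ : x ∈ Icc α β)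
    simp only [mem_ofPred_eq, Pi.sub_apply] at this
    linarith)
  rw [deriv_add_const] at this
  exact absurd (H_lt_of_mem h ⟨hα.trans hm.1, hm.2.trans hβ⟩ (hφd m hmI)) (not_lt.2 this)

/-- Compare with `prim - ε * D`, whose slope is strictly inside the sublevel interval. The minimum
of the difference is not interior, and the state constraint excludes `1`, so it is at `α`; smallness
of `ε` then contradicts the assumed gap. -/
theorem le_of_stateConstraintAtOne (h : ∀ s ∈ Icc (0 : ℝ) 1, ∃ p, 𝓗.H e s p < a)
    (hα : 0 ≤ α) (hα1 : α < 1) (hw : ContinuousOn w (Icc α 1))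
    (hsup : ∀ r ∈ Ioo α 1, IsViscSuperAt (𝓗.H e) a w r)
    (hsc : StateConstraintAtOne (𝓗.H e) a w) :
    w α + (𝓗.prim a e 1 - 𝓗.prim a e α) ≤ w 1 := by
  have h' : 𝓗.LevelNonempty a e := fun s hs => (h s hs).imp fun _ hp => hp.le
  by_contra! hlt
  set D : ℝ → ℝ := fun t => 𝓗.prim a e t - 𝓗.primMinus a e t with hD
  -- `c` makes the loss `ε * (D 1 - D α)` smaller than the gap; the cap `1 / 2` keeps the slope
  -- above `sigmaMinus`.
  obtain ⟨c, hc0, hc⟩ := exists_pos_mul_lt (sub_pos.2 hlt) (D 1 - D α)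
  set ε := min c (1 / 2) with hε
  have hε0 : 0 < ε := lt_min hc0 (by norm_num)
  have hε1 : ε ≤ 1 / 2 := min_le_right _ _
  have hDD : 0 ≤ D 1 - D α := sub_nonneg.2 (monotone_prim_sub_primMinus h' hα1.le)
  have hεc : (D 1 - D α) * ε ≤ (D 1 - D α) * c :=
    mul_le_mul_of_nonneg_left (min_le_left _ _) hDD
  set φ : ℝ → ℝ := fun t => 𝓗.prim a e t - ε * D t with hφ
  have hφd : ∀ r ∈ Icc (0 : ℝ) 1, HasDerivAt φ
      (𝓗.sigmaPlus a e r - ε * (𝓗.sigmaPlus a e r - 𝓗.sigmaMinus a e r)) r := fun r hr =>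
    (hasDerivAt_prim_of_mem h' hr).sub
      (((hasDerivAt_prim_of_mem h' hr).sub (hasDerivAt_primMinus_of_mem h' hr)).const_mul ε)
  have hφC : ContDiff ℝ 1 φ := (contDiff_prim h').sub
    (contDiff_const.mul ((contDiff_prim h').sub (contDiff_primMinus h')))
  have hφI : ∀ r ∈ Icc (0 : ℝ) 1,
      deriv φ r ∈ Ioo (𝓗.sigmaMinus a e r) (𝓗.sigmaPlus a e r) := by
    intro r hr
    obtain ⟨p, hp⟩ := h r hr
    have hlt := sub_pos.2 (sigmaMinus_lt_sigmaPlus hr hp)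
    rw [(hφd r hr).deriv]
    constructor <;> nlinarith
  obtain ⟨m, rfl | rfl, hm⟩ := exists_endpoint_isMinOn h' hα hα1.le le_rfl hw hsup hφC
    fun r hr => hφI r ⟨hα.trans hr.1.le, hr.2.le⟩
  · have := hm 1 ⟨hα1.le, le_rfl⟩
    simp only [hφ] at this
    linarith
  · have h1 : (1 : ℝ) ∈ Icc (0 : ℝ) 1 := ⟨zero_le_one, le_rfl⟩
    have := hsc (fun x => φ x + (w 1 - φ 1)) (hφC.add contDiff_const) (by ring) (by
      filter_upwards [Ioo_mem_nhdsLT hα1] with x hx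
      linarith [hm x ⟨hx.1.le, hx.2.le⟩])
    rw [deriv_add_const] at this
    exact absurd (H_lt_of_mem h' h1 (hφI 1 h1)) (not_lt.2 this)

/-- If `w r` were below both bounds, take a strict `C¹` subsolution with slope near `sigmaPlus` left
of `r` and near `sigmaMinus` right of it. Its difference from `w` would then be smaller at `r` than
at either endpoint, so the minimum would be interior. -/
theorem le_or_le_of_isViscSuperAt (h : ∀ s ∈ Icc (0 : ℝ) 1, ∃ p, 𝓗.H e s p < a)
    (hα : 0 ≤ α) (hβ : β ≤ 1) (hr : r ∈ Ioo α β) (hw : ContinuousOn w (Icc α β))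
    (hsup : ∀ r ∈ Ioo α β, IsViscSuperAt (𝓗.H e) a w r) :
    w α + (𝓗.prim a e r - 𝓗.prim a e α) ≤ w r ∨
      w β + (𝓗.primMinus a e r - 𝓗.primMinus a e β) ≤ w r := by
  have h' : 𝓗.LevelNonempty a e := fun s hs => (h s hs).imp fun _ hp => hp.le
  by_contra! hlt
  set D : ℝ → ℝ := fun t => 𝓗.prim a e t - 𝓗.primMinus a e t with hD
  have hDmono : Monotone D := monotone_prim_sub_primMinus h'
  have hDc : Continuous D := (continuous_prim h').sub (continuous_primMinus h')
  set η₁ := w α + (𝓗.prim a e r - 𝓗.prim a e α) - w r with hη₁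
  set η₂ := w β + (𝓗.primMinus a e r - 𝓗.primMinus a e β) - w r with hη₂
  have hη₁0 : 0 < η₁ := sub_pos.2 hlt.1
  have hη₂0 : 0 < η₂ := sub_pos.2 hlt.2
  -- The slope must change continuously; this is done on `[r, r₁]`, short enough to cost less than
  -- half of `η₂`.
  obtain ⟨r₁, hDr₁, hr₁⟩ : ∃ r₁, D r₁ < D r + η₂ / 2 ∧ r₁ ∈ Ioo r β := by
    have h1 : ∀ᶠ t in 𝓝[>] r, D t < D r + η₂ / 2 :=
      nhdsWithin_le_nhds (hDc.continuousAt.eventually_lt_const (by linarith))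
    exact (h1.and (Ioo_mem_nhdsGT hr.2)).exists
  obtain ⟨c, hc0, hc⟩ := exists_pos_mul_lt (lt_min hη₁0 (half_pos hη₂0)) (D β - D α)
  set ε := min c (1 / 4) with hε
  have hε0 : 0 < ε := lt_min hc0 (by norm_num)
  have hε1 : ε ≤ 1 / 4 := min_le_right _ _
  have hεD : ∀ C, C ≤ D β - D α → 0 ≤ C → ε * C < min η₁ (η₂ / 2) := by
    intro C hC hC0
    calc ε * C ≤ c * (D β - D α) := mul_le_mul (min_le_left _ _) hC hC0 hc0.le
      _ = (D β - D α) * c := mul_comm _ _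
      _ < _ := hc
  -- The weight of `sigmaMinus` in the slope: `ε` up to `r` and `1 - ε` from `r₁` on, so the slope
  -- remains strictly inside the interval.
  set l : ℝ → ℝ := fun x => max ε (min (1 - ε) ((x - r) / (r₁ - r))) with hl
  have hlc : Continuous l := by simp only [hl]; fun_prop
  have hl_ge : ∀ x, ε ≤ l x := fun x => le_max_left _ _
  have hl_le : ∀ x, l x ≤ 1 - ε := fun x => max_le (by linarith) (min_le_left _ _)
  set δ : ℝ → ℝ := fun x => 𝓗.sigmaPlus a e (projIcc 0 1 zero_le_one x) -
    𝓗.sigmaMinus a e (projIcc 0 1 zero_le_one x) with hδ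
  have hDd : ∀ x, HasDerivAt D (δ x) x := fun x =>
    (hasDerivAt_prim h' x).sub (hasDerivAt_primMinus h' x)
  have hδ0 : ∀ x, 0 < δ x := fun x => by
    obtain ⟨p, hp⟩ := h _ (projIcc _ _ _ x).2
    exact sub_pos.2 (sigmaMinus_lt_sigmaPlus (projIcc _ _ _ x).2 hp)
  have hδc : Continuous δ := by
    have : δ = deriv D := funext fun x => (hDd x).deriv.symm
    rw [this]
    exact ((contDiff_prim h').sub (contDiff_primMinus h')).continuous_deriv le_rfl
  have hlδ : Continuous fun x => l x * δ x := hlc.mul hδc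
  have hint : ∀ x y, ∫ t in x..y, δ t = D y - D x := fun x y =>
    intervalIntegral.integral_eq_sub_of_hasDerivAt (fun t _ => hDd t)
      (hδc.intervalIntegrable _ _)
  set φ : ℝ → ℝ := fun x => 𝓗.prim a e x - ∫ t in r..x, l t * δ t with hφ
  have hφd : ∀ x, HasDerivAt φ
      (𝓗.sigmaPlus a e (projIcc 0 1 zero_le_one x) - l x * δ x) x := fun x =>
    (hasDerivAt_prim h' x).sub (hlδ.integral_hasStrictDerivAt r x).hasDerivAt
  have hφC : ContDiff ℝ 1 φ := by
    rw [contDiff_one_iff_deriv]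
    refine ⟨fun x => (hφd x).differentiableAt, ?_⟩
    have : deriv φ = _ := funext fun x => (hφd x).deriv
    rw [this]
    exact (continuous_sigmaPlus_proj h').sub hlδ
  obtain ⟨m, hm, hmin⟩ := exists_endpoint_isMinOn h' hα (hr.1.trans hr.2).le hβ hw hsup hφC
    fun x hx => by
      rw [(hφd x).deriv]
      have h1 := hδ0 x
      have h2 := hl_ge x
      have h3 := hl_le x
      simp only [hδ] at h1 ⊢
      rw [projIcc_of_mem _ ⟨hα.trans hx.1.le, hx.2.le.trans hβ⟩] at h1 ⊢
      constructor <;> nlinarith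
  have hminr := hmin r ⟨hr.1.le, hr.2.le⟩
  have hφr : φ r = 𝓗.prim a e r := by simp [hφ]
  rcases hm with rfl | rfl
  · have h1 : ∫ t in r..m, l t * δ t = ε * (D m - D r) := by
      rw [← hint, ← intervalIntegral.integral_const_mul]
      refine intervalIntegral.integral_congr fun x hx => ?_
      rw [uIcc_of_ge hr.1.le] at hx
      have : (x - r) / (r₁ - r) ≤ 0 :=
        div_nonpos_of_nonpos_of_nonneg (by linarith [hx.2]) (by linarith [hr₁.1])
      simp only [hl]
      rw [min_eq_right (by linarith), max_eq_left (by linarith)]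
    have h2 : φ m = 𝓗.prim a e m - ε * (D m - D r) := by rw [← h1]
    have h3 := hεD (D r - D m) (by linarith [hDmono hr.2.le]) (by linarith [hDmono hr.1.le])
    have h4 := h3.trans_le (min_le_left _ _)
    rw [h2, hφr] at hminr
    linarith
  · have h1 : ∫ t in r₁..m, l t * δ t = (1 - ε) * (D m - D r₁) := by
      rw [← hint, ← intervalIntegral.integral_const_mul]
      refine intervalIntegral.integral_congr fun x hx => ?_
      rw [uIcc_of_le hr₁.2.le] at hx
      have : 1 ≤ (x - r) / (r₁ - r) := by
        rw [one_le_div (by linarith [hr₁.1])]; linarith [hx.1]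
      simp only [hl]
      rw [min_eq_left (by linarith), max_eq_right (by linarith)]
    have h2 : 0 ≤ ∫ t in r..r₁, l t * δ t :=
      intervalIntegral.integral_nonneg hr₁.1.le fun x _ =>
        mul_nonneg (hε0.le.trans (hl_ge x)) (hδ0 x).le
    have h3 : φ m = 𝓗.prim a e m - ((∫ t in r..r₁, l t * δ t) + (1 - ε) * (D m - D r₁)) := by
      rw [← h1, intervalIntegral.integral_add_adjacent_intervals
        (hlδ.intervalIntegrable _ _) (hlδ.intervalIntegrable _ _)]
    have h4 := (hεD (D m - D r₁) (by linarith [hDmono (hr.1.trans hr₁.1).le])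
      (by linarith [hDmono hr₁.2.le])).trans_le (min_le_right _ _)
    rw [h3, hφr] at hminr
    have h5 : D m - D r = 𝓗.prim a e m - 𝓗.prim a e r -
      (𝓗.primMinus a e m - 𝓗.primMinus a e r) := by simp only [hD]; ring
    linarith

end NetworkHamiltonian

namespace NetworkHamiltonian

variable {N : ℕ} {E : Type*} {Γ : EmbeddedNetwork N E} {𝓗 : NetworkHamiltonian Γ}
  {a r s : ℝ} {e : E} {x y : EuclideanSpace ℝ (Fin N)}
  {f g : EuclideanSpace ℝ (Fin N) → ℝ} {Γ' T : Set (EuclideanSpace ℝ (Fin N))}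

/-! ### Extension of subsolutions from sets that contain the vertices -/

/-- A McShane extension made arc by arc. As `T` contains the vertices, a point outside `T` lies on a
single arc up to reversal, so the infimum over the points of `T` on that arc suffices. The last
clause records that the infimum is not lowered further. -/
theorem exists_isSub_extension (h : ∀ e, 𝓗.LevelNonempty a e) (hT : Γ.vertices ⊆ T)
    {v : EuclideanSpace ℝ (Fin N) → ℝ}
    (hv : ∀ e, ∀ s ∈ Icc (0 : ℝ) 1, ∀ t ∈ Icc (0 : ℝ) 1, Γ.arc e s ∈ T → Γ.arc e t ∈ T →
      v (Γ.arc e t) - v (Γ.arc e s) ≤ 𝓗.arcDist a e s t) :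
    ∃ f, 𝓗.IsSub a f ∧ EqOn f v T ∧ ∀ e, ∀ r ∈ Icc (0 : ℝ) 1, Γ.arc e r ∉ T → ∀ l,
      (∀ s ∈ Icc (0 : ℝ) 1, Γ.arc e s ∈ T → l ≤ v (Γ.arc e s) + 𝓗.arcDist a e s r) →
      l ≤ f (Γ.arc e r) := by
  classical
  let A : E → ℝ → Set ℝ := fun e r =>
    {l | ∃ s ∈ Icc (0 : ℝ) 1, Γ.arc e s ∈ T ∧ v (Γ.arc e s) + 𝓗.arcDist a e s r = l}
  have hArev : ∀ e r, A (Γ.rev e) (1 - r) ⊆ A e r := by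
    rintro e r l ⟨s, hs, hsT, rfl⟩
    refine ⟨1 - s, one_sub_mem hs, by rwa [← Γ.arc_rev e s hs], ?_⟩
    rw [Γ.arc_rev e s hs, ← arcDist_rev (e := e) (t := r), sub_sub_cancel]
  have h0 : ∀ e, Γ.arc e 0 ∈ T := fun e => hT (Γ.arc_zero_mem_vertices e)
  have h0I : (0 : ℝ) ∈ Icc (0 : ℝ) 1 := ⟨le_rfl, zero_le_one⟩
  have hAne : ∀ e r, (A e r).Nonempty := fun e r => ⟨_, 0, h0I, h0 e, rfl⟩
  have hAbdd : ∀ e r, BddBelow (A e r) := by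
    refine fun e r => ⟨v (Γ.arc e 0) - 𝓗.arcDist a e r 0, ?_⟩
    rintro l ⟨s, hs, hsT, rfl⟩
    have h1 := hv e s hs 0 h0I hsT (h0 e)
    have h2 := arcDist_triangle (𝓗 := 𝓗) (a := a) (e := e) (s := s) (r := r) (t := 0)
    linarith
  let f : EuclideanSpace ℝ (Fin N) → ℝ := fun z =>
    if z ∈ T then v z else sInf {l | ∃ e, ∃ r ∈ Icc (0 : ℝ) 1, Γ.arc e r = z ∧ l ∈ A e r}
  have hfT : ∀ z ∈ T, f z = v z := fun z hz => if_pos hz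
  have hfA : ∀ e, ∀ r ∈ Icc (0 : ℝ) 1, Γ.arc e r ∉ T → f (Γ.arc e r) = sInf (A e r) := by
    intro e r hr hrT
    have : {l | ∃ d, ∃ t ∈ Icc (0 : ℝ) 1, Γ.arc d t = Γ.arc e r ∧ l ∈ A d t} = A e r := by
      ext l
      constructor
      · rintro ⟨d, t, ht, hd, hl⟩
        rcases Γ.eq_or_eq_rev_of_arc_eq hr ht (fun hV => hrT (hT hV)) hd with
          ⟨rfl, rfl⟩ | ⟨rfl, rfl⟩
        · exact hl
        · exact hArev e r hl
      · exact fun hl => ⟨e, r, hr, rfl, hl⟩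
    simp only [f]
    rw [if_neg hrT, this]
  refine ⟨f, (isSub_iff_arcDist h).2 ?_, hfT, fun e r hr hrT l hl => ?_⟩
  · intro e s hs t ht
    by_cases hsT : Γ.arc e s ∈ T <;> by_cases htT : Γ.arc e t ∈ T
    · rw [hfT _ hsT, hfT _ htT]
      exact hv e s hs t ht hsT htT
    · rw [hfT _ hsT, hfA e t ht htT, sub_le_iff_le_add']
      exact csInf_le (hAbdd e t) ⟨s, hs, hsT, rfl⟩
    · rw [hfA e s hs hsT, hfT _ htT, sub_le_comm]
      refine le_csInf (hAne e s) ?_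
      rintro l ⟨q, hq, hqT, rfl⟩
      have h1 := hv e q hq t ht hqT htT
      have h2 := arcDist_triangle (𝓗 := 𝓗) (a := a) (e := e) (s := q) (r := s) (t := t)
      linarith
    · rw [hfA e s hs hsT, hfA e t ht htT, sub_le_comm]
      refine le_csInf (hAne e s) ?_
      rintro l ⟨q, hq, hqT, rfl⟩
      have h1 := csInf_le (hAbdd e t) ⟨q, hq, hqT, rfl⟩
      have h2 := arcDist_triangle (𝓗 := 𝓗) (a := a) (e := e) (s := q) (r := s) (t := t)
      linarith
  · rw [hfA e r hr hrT]
    refine le_csInf (hAne e r) ?_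
    rintro _ ⟨s, hs, hsT, rfl⟩
    exact hl s hs hsT

/-! ### The Hopf–Lax function -/

theorem bddBelow_hopfLaxValues (hn : 𝓗.ClosedCurvesNonneg a) (hΓ' : Γ' ⊆ Γ.support)
    (hne : Γ'.Nonempty) (hg : 𝓗.IsAdmissibleTrace a Γ' g) (hx : x ∈ Γ.support) :
    BddBelow (𝓗.hopfLaxValues a Γ' g x) := by
  obtain ⟨y₀, hy₀⟩ := hne
  refine ⟨g y₀ - 𝓗.semidistance a x y₀, ?_⟩
  rintro _ ⟨y, hy, rfl⟩
  have h1 := hg y₀ hy₀ y hy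
  have h2 := hn.semidistance_triangle (hΓ' hy) hx (hΓ' hy₀)
  simp only
  linarith

theorem hopfLax_le (hn : 𝓗.ClosedCurvesNonneg a) (hΓ' : Γ' ⊆ Γ.support)
    (hg : 𝓗.IsAdmissibleTrace a Γ' g) (hx : x ∈ Γ.support) (hy : y ∈ Γ') :
    𝓗.hopfLax a Γ' g x ≤ g y + 𝓗.semidistance a y x :=
  csInf_le (bddBelow_hopfLaxValues hn hΓ' ⟨y, hy⟩ hg hx) ⟨y, hy, rfl⟩

theorem le_hopfLax (hne : Γ'.Nonempty) {l : ℝ}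
    (hl : ∀ y ∈ Γ', l ≤ g y + 𝓗.semidistance a y x) : l ≤ 𝓗.hopfLax a Γ' g x := by
  refine le_csInf (hne.image _) ?_
  rintro _ ⟨y, hy, rfl⟩
  exact hl y hy

theorem hopfLax_eq (hn : 𝓗.ClosedCurvesNonneg a) (hΓ' : Γ' ⊆ Γ.support)
    (hg : 𝓗.IsAdmissibleTrace a Γ' g) : EqOn (𝓗.hopfLax a Γ' g) g Γ' := by
  intro x hx
  refine le_antisymm ?_ (le_hopfLax ⟨x, hx⟩ fun y hy => ?_)
  · have := hopfLax_le hn hΓ' hg (hΓ' hx) hx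
    rwa [hn.semidistance_self (hΓ' hx), add_zero] at this
  · linarith [hg x hx y hy]

theorem isSub_hopfLax (hn : 𝓗.ClosedCurvesNonneg a) (h : ∀ e, 𝓗.LevelNonempty a e)
    (hΓ' : Γ' ⊆ Γ.support) (hne : Γ'.Nonempty) (hg : 𝓗.IsAdmissibleTrace a Γ' g) :
    𝓗.IsSub a (𝓗.hopfLax a Γ' g) := by
  intro e s t hs hst ht
  rw [sub_le_comm]
  refine le_hopfLax hne fun y hy => ?_
  have h1 := hopfLax_le hn hΓ' hg (Γ.arc_mem_support (e := e) ⟨hs.trans hst, ht⟩) hy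
  have h2 := hn.isSub_semidistance h (hΓ' hy) e s t hs hst ht
  linarith

/-- This is the maximality of the Hopf–Lax function; the existence proofs use it against competitors
that agree with it on `Γ'`. -/
theorem IsSub.le_hopfLax (hf : 𝓗.IsSub a f) (h : ∀ e, 𝓗.LevelNonempty a e)
    (hΓ' : Γ' ⊆ Γ.support) (hne : Γ'.Nonempty) (hfg : ∀ y ∈ Γ', f y ≤ g y)
    (hx : x ∈ Γ.support) : f x ≤ 𝓗.hopfLax a Γ' g x :=
  NetworkHamiltonian.le_hopfLax hne fun y hy => by
    linarith [hfg y hy, hf.le_semidistance h (hΓ' hy) hx]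

theorem isLeast_hopfLax [Finite E] (hn : 𝓗.ClosedCurvesNonneg a)
    (h : ∀ e, 𝓗.LevelNonempty a e) (hΓ'c : IsClosed Γ') (hΓ' : Γ' ⊆ Γ.support)
    (hne : Γ'.Nonempty) (hg : 𝓗.IsAdmissibleTrace a Γ' g) (hx : x ∈ Γ.support) :
    IsLeast (𝓗.hopfLaxValues a Γ' g x) (𝓗.hopfLax a Γ' g x) := by
  have hcomp : IsCompact Γ' := Γ.isCompact_support.of_isClosed_subset hΓ'c hΓ'
  have hv := (isSub_hopfLax hn h hΓ' hne hg).continuousOn h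
  have hS := (hn.isSub_neg_semidistance h hx).continuousOn h
  -- Continuity of `g` is not assumed; on `Γ'` it coincides with the Hopf–Lax function, which is
  -- continuous.
  obtain ⟨y, hy, hmin⟩ := hcomp.exists_isMinOn hne ((hv.sub hS).mono hΓ')
  have hmin' : ∀ z ∈ Γ', g y + 𝓗.semidistance a y x ≤ g z + 𝓗.semidistance a z x := by
    intro z hz
    have := hmin hz
    simp only [mem_ofPred_eq, Pi.sub_apply, sub_neg_eq_add] at this
    rwa [hopfLax_eq hn hΓ' hg hy, hopfLax_eq hn hΓ' hg hz] at this
  have heq : 𝓗.hopfLax a Γ' g x = g y + 𝓗.semidistance a y x :=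
    (hopfLax_le hn hΓ' hg hx hy).antisymm (le_hopfLax hne hmin')
  refine ⟨⟨y, hy, heq.symm⟩, ?_⟩
  rintro _ ⟨z, hz, rfl⟩
  exact hopfLax_le hn hΓ' hg hx hz

theorem isCompact_arc_preimage (e : E) (hT : IsClosed T) :
    IsCompact {s | s ∈ Icc (0 : ℝ) 1 ∧ Γ.arc e s ∈ T} :=
  isCompact_Icc.of_isClosed_subset
    ((Γ.continuousOn_arc e).preimage_isClosed_of_isClosed isClosed_Icc hT) inter_subset_left

/-- Re-extend `v` from `Γ'` and the vertices. By maximality the extension is at most `v` at the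
point, while it is at least the minimum of the transported values, attained by compactness. Since
`v` is a subsolution, equality holds. -/
theorem exists_hopfLax_eq_add_arcDist [Finite E] (hn : 𝓗.ClosedCurvesNonneg a)
    (h : ∀ e, 𝓗.LevelNonempty a e) (hΓ'c : IsClosed Γ') (hΓ' : Γ' ⊆ Γ.support)
    (hne : Γ'.Nonempty) (hg : 𝓗.IsAdmissibleTrace a Γ' g) (hr : r ∈ Ioo (0 : ℝ) 1)
    (hx : Γ.arc e r ∉ Γ') : ∃ s ∈ Icc (0 : ℝ) 1, s ≠ r ∧ 𝓗.hopfLax a Γ' g (Γ.arc e r) =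
      𝓗.hopfLax a Γ' g (Γ.arc e s) + 𝓗.arcDist a e s r := by
  have hr' : r ∈ Icc (0 : ℝ) 1 := Ioo_subset_Icc_self hr
  set v := 𝓗.hopfLax a Γ' g
  have hv : 𝓗.IsSub a v := isSub_hopfLax hn h hΓ' hne hg
  have hrT : Γ.arc e r ∉ Γ' ∪ Γ.vertices := fun hT => hT.elim hx (Γ.arc_notMem_vertices hr)
  obtain ⟨f, hf, hfv, hfl⟩ := exists_isSub_extension h (subset_union_right (s := Γ'))
    (v := v) fun e s hs t ht _ _ => hv.le_arcDist h hs ht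
  obtain ⟨s, ⟨hs, hsT⟩, hmin⟩ := (isCompact_arc_preimage (Γ := Γ) e
    (hΓ'c.union Γ.finite_vertices.isClosed)).exists_isMinOn
    ⟨0, ⟨le_rfl, zero_le_one⟩, Or.inr (Γ.arc_zero_mem_vertices e)⟩
    (((hv.continuousOn_comp_arc h e).mono fun _ ht => ht.1).add
      (continuous_arcDist_left (h e) r).continuousOn)
  refine ⟨s, hs, fun hsr => hrT (hsr ▸ hsT), ?_⟩
  have h1 := hv.le_arcDist h hs hr' (e := e)
  have h2 : f (Γ.arc e r) ≤ v (Γ.arc e r) := hf.le_hopfLax h hΓ' hne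
    (fun y hy => (hfv (Or.inl hy)).le.trans (hopfLax_eq hn hΓ' hg hy).le)
    (Γ.arc_mem_support hr')
  have h3 := hfl e r hr' hrT (v (Γ.arc e s) + 𝓗.arcDist a e s r)
    fun t ht htT => hmin ⟨ht, htT⟩
  linarith

theorem isViscSuperAt_hopfLax [Finite E] (hn : 𝓗.ClosedCurvesNonneg a)
    (h : ∀ e, 𝓗.LevelNonempty a e) (hΓ'c : IsClosed Γ') (hΓ' : Γ' ⊆ Γ.support)
    (hne : Γ'.Nonempty) (hg : 𝓗.IsAdmissibleTrace a Γ' g) (hr : r ∈ Ioo (0 : ℝ) 1)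
    (hx : Γ.arc e r ∉ Γ') :
    IsViscSuperAt (𝓗.H e) a (fun t => 𝓗.hopfLax a Γ' g (Γ.arc e t)) r := by
  have hv := isSub_hopfLax hn h hΓ' hne hg
  obtain ⟨s, hs, hsr, heq⟩ := exists_hopfLax_eq_add_arcDist hn h hΓ'c hΓ' hne hg hr hx
  have hI : ∀ᶠ t in 𝓝 r, t ∈ Icc (0 : ℝ) 1 := Icc_mem_nhds hr.1 hr.2
  rcases hsr.lt_or_gt with hlt | hlt
  · refine isViscSuperAt_of_le_prim (h e) (Ioo_subset_Icc_self hr) ?_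
    rw [arcDist_of_le (h e) hlt.le] at heq
    filter_upwards [hI, lt_mem_nhds hlt] with t ht hst
    have := hv e s t hs.1 (le_of_lt hst) ht.2
    linarith
  · refine isViscSuperAt_of_le_primMinus (h e) (Ioo_subset_Icc_self hr) ?_
    rw [arcDist_of_ge (h e) hlt.le] at heq
    filter_upwards [hI, gt_mem_nhds hlt] with t ht hst
    have := hv.le_arcDist h hs ht (e := e)
    rw [arcDist_of_ge (h e) (le_of_lt hst)] at this
    linarith

/-- If no incoming arc were saturated, compactness and finiteness would leave a uniform margin, so
`v` could be raised at this one vertex and extended to a subsolution with the same trace, against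
maximality. -/
theorem exists_hopfLax_vertex_eq [Finite E] (hn : 𝓗.ClosedCurvesNonneg a)
    (h : ∀ e, 𝓗.LevelNonempty a e) (hΓ'c : IsClosed Γ') (hΓ' : Γ' ⊆ Γ.support)
    (hne : Γ'.Nonempty) (hg : 𝓗.IsAdmissibleTrace a Γ' g) (hxV : x ∈ Γ.vertices)
    (hx : x ∉ Γ') : ∃ e, Γ.arc e 1 = x ∧ ∃ s ∈ Ico (0 : ℝ) 1,
      𝓗.hopfLax a Γ' g x =
        𝓗.hopfLax a Γ' g (Γ.arc e s) + (𝓗.prim a e 1 - 𝓗.prim a e s) := by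
  classical
  set v := 𝓗.hopfLax a Γ' g
  have hv : 𝓗.IsSub a v := isSub_hopfLax hn h hΓ' hne hg
  by_contra! hcon
  set T₀ := Γ' ∪ (Γ.vertices \ {x}) with hT₀
  have hT₀c : IsClosed T₀ := hΓ'c.union (Γ.finite_vertices.subset sdiff_subset).isClosed
  have hxT₀ : x ∉ T₀ := fun hT => hT.elim hx fun h => h.2 rfl
  have hlt : ∀ e, Γ.arc e 1 = x → ∀ s ∈ Icc (0 : ℝ) 1, Γ.arc e s ∈ T₀ →
      v x < v (Γ.arc e s) + 𝓗.arcDist a e s 1 := by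
    intro e he s hs hsT
    have hs1 : s ≠ 1 := by rintro rfl; exact hxT₀ (he ▸ hsT)
    have h1 := hcon e he s ⟨hs.1, hs.2.lt_of_ne hs1⟩
    have h2 := hv e s 1 hs.1 hs.2 le_rfl
    rw [arcDist_of_le (h e) hs.2]
    rw [he] at h2
    exact lt_of_le_of_ne (by linarith) h1
  have hη : ∀ e, ∃ η > 0, Γ.arc e 1 = x → ∀ s ∈ Icc (0 : ℝ) 1, Γ.arc e s ∈ T₀ →
      v x + η ≤ v (Γ.arc e s) + 𝓗.arcDist a e s 1 := by
    intro e
    by_cases he : Γ.arc e 1 = x ∧ ({s | s ∈ Icc (0 : ℝ) 1 ∧ Γ.arc e s ∈ T₀}).Nonempty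
    · obtain ⟨s, ⟨hs, hsT⟩, hmin⟩ := (isCompact_arc_preimage (Γ := Γ) e hT₀c).exists_isMinOn he.2
        (((hv.continuousOn_comp_arc h e).mono fun _ ht => ht.1).add
          (continuous_arcDist_left (h e) 1).continuousOn)
      refine ⟨_, sub_pos.2 (hlt e he.1 s hs hsT), fun _ t ht htT => ?_⟩
      have := hmin ⟨ht, htT⟩
      simp only [mem_ofPred_eq, Pi.add_apply] at this
      linarith
    · exact ⟨1, one_pos, fun he1 s hs hsT => absurd ⟨he1, s, hs, hsT⟩ he⟩
  choose η hη0 hη using hη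
  obtain ⟨ε, hε0, hε⟩ : ∃ ε > 0, ∀ e, ε ≤ η e := by
    have := Fintype.ofFinite E
    by_cases hE : Nonempty E
    · exact ⟨Finset.univ.inf' Finset.univ_nonempty η, (Finset.lt_inf'_iff _).2 fun e _ => hη0 e,
        fun e => Finset.inf'_le _ (Finset.mem_univ e)⟩
    · exact ⟨1, one_pos, fun e => absurd ⟨e⟩ hE⟩
  have hmem : ∀ z ∈ Γ' ∪ Γ.vertices, z ≠ x → z ∈ T₀ := fun z hz hzx =>
    hz.imp id fun hz => ⟨hz, hzx⟩
  have hraise : ∀ e, ∀ s ∈ Icc (0 : ℝ) 1, ∀ t ∈ Icc (0 : ℝ) 1,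
      Γ.arc e s ∈ T₀ → Γ.arc e t = x → v x + ε ≤ v (Γ.arc e s) + 𝓗.arcDist a e s t := by
    intro e s hs t ht hsT htx
    rcases Γ.eq_zero_or_one_of_mem_vertices ht (htx ▸ hxV) with rfl | rfl
    · have := hη (Γ.rev e) (by rw [Γ.arc_rev_one, htx]) (1 - s) (one_sub_mem hs)
        (by rwa [Γ.arc_rev' hs])
      have h2 := arcDist_rev (𝓗 := 𝓗) (a := a) (e := e) (s := s) (t := 0)
      rw [sub_zero] at h2
      rw [Γ.arc_rev' hs, h2] at this
      linarith [hε (Γ.rev e)]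
    · linarith [hη e htx s hs hsT, hε e]
  obtain ⟨f, hf, hfv, -⟩ := exists_isSub_extension h (subset_union_right (s := Γ'))
    (v := fun z => if z = x then v x + ε else v z) fun e s hs t ht hsT htT => by
      -- Raising the value at `x` tightens only the inequalities that arrive at `x` from another
      -- point, where `hraise` has room; if both points are `x`, the raise cancels.
      by_cases hsx : Γ.arc e s = x <;> by_cases htx : Γ.arc e t = x
      · have := hv.le_arcDist h hs ht (e := e)
        rw [hsx, htx] at this
        simp only [hsx, htx, if_true]
        linarith
      · have := hv.le_arcDist h hs ht (e := e)
        rw [hsx] at this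
        simp only [hsx, htx, if_true, if_false]
        linarith
      · have := hraise e s hs t ht (hmem _ hsT hsx) htx
        simp only [hsx, htx, if_true, if_false]
        linarith
      · simp only [hsx, htx, if_false]
        exact hv.le_arcDist h hs ht
  have h2 : f x ≤ v x := hf.le_hopfLax h hΓ' hne (fun y hy => by
    have hyx : y ≠ x := by rintro rfl; exact hx hy
    rw [hfv (Or.inl hy)]
    simp only [hyx, if_false]
    exact (hopfLax_eq hn hΓ' hg hy).le) (Γ.vertices_subset_support hxV)
  rw [hfv (Or.inr hxV)] at h2
  simp only [if_true] at h2
  linarith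

theorem exists_stateConstraintAtOne_hopfLax [Finite E] (hn : 𝓗.ClosedCurvesNonneg a)
    (h : ∀ e, 𝓗.LevelNonempty a e) (hΓ'c : IsClosed Γ') (hΓ' : Γ' ⊆ Γ.support)
    (hne : Γ'.Nonempty) (hg : 𝓗.IsAdmissibleTrace a Γ' g) (hxV : x ∈ Γ.vertices)
    (hx : x ∉ Γ') : ∃ e, Γ.arc e 1 = x ∧
      StateConstraintAtOne (𝓗.H e) a (fun t => 𝓗.hopfLax a Γ' g (Γ.arc e t)) := by
  have hv := isSub_hopfLax hn h hΓ' hne hg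
  obtain ⟨e, he, s, hs, heq⟩ := exists_hopfLax_vertex_eq hn h hΓ'c hΓ' hne hg hxV hx
  refine ⟨e, he, stateConstraintAtOne_of_le_prim (h e) ?_⟩
  filter_upwards [Ioo_mem_nhdsLT hs.2] with t ht
  have := hv e s t hs.1 ht.1.le ht.2.le
  rw [he]
  linarith

end NetworkHamiltonian

/-! ### Cycles in finite networks -/

namespace EmbeddedNetwork

variable {N : ℕ} {E : Type*} {Γ : EmbeddedNetwork N E} {x y : EuclideanSpace ℝ (Fin N)}
  {l : E → ℝ} {u : EuclideanSpace ℝ (Fin N) → ℝ}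

/-- Iterate a choice of predecessors; two iterates coincide since `E` is finite. The iteration runs
backwards, so the later iterate starts the path. -/
theorem exists_isCycle_of_forall_exists_pred [Finite E] {B : Set E} (hB : B.Nonempty)
    (hpred : ∀ e ∈ B, ∃ d ∈ B, Γ.arc d 1 = Γ.arc e 0) :
    ∃ ξ, Γ.IsCycle ξ ∧ ∀ e ∈ ξ, e ∈ B := by
  choose! p hpB hp using hpred
  obtain ⟨e₀, he₀⟩ := hB
  have hc : ∀ n, p^[n] e₀ ∈ B := fun n => by
    induction n with
    | zero => exact he₀
    | succ n ih => rw [Function.iterate_succ_apply']; exact hpB _ ih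
  have hpath : ∀ i k, ∃ ξ : List E, ξ.length = k ∧
      Γ.IsPath ξ (Γ.arc (p^[i + k] e₀) 0) (Γ.arc (p^[i] e₀) 0) ∧ ∀ e ∈ ξ, e ∈ B := by
    intro i k
    induction k with
    | zero => exact ⟨[], rfl, rfl, by simp⟩
    | succ k ih =>
      obtain ⟨ξ, hlen, hξ, hξB⟩ := ih
      refine ⟨p^[i + (k + 1)] e₀ :: ξ, by simp [hlen], ⟨rfl, ?_⟩, ?_⟩
      · rw [← add_assoc, Function.iterate_succ_apply', hp _ (hc _)]
        exact hξ
      · rintro e (_ | ⟨_, he⟩)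
        · exact hc _
        · exact hξB e he
  obtain ⟨i, j, hij, heq⟩ := Finite.exists_ne_map_eq_of_infinite fun n => p^[n] e₀
  wlog hlt : i < j generalizing i j
  · exact this j i hij.symm heq.symm (lt_of_le_of_ne (not_lt.1 hlt) hij.symm)
  obtain ⟨k, rfl⟩ := Nat.exists_eq_add_of_lt hlt
  obtain ⟨ξ, hlen, hξ, hξB⟩ := hpath i (k + 1)
  refine ⟨ξ, ⟨by rintro rfl; simp at hlen, Γ.arc (p^[i] e₀) 0, ?_⟩, hξB⟩
  simp only [add_assoc] at heq
  rwa [← heq] at hξ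

theorem sum_eq_of_isPath {ξ : List E} (hξ : Γ.IsPath ξ x y)
    (hu : ∀ e ∈ ξ, u (Γ.arc e 1) = u (Γ.arc e 0) + l e) : (ξ.map l).sum = u y - u x := by
  induction ξ generalizing x with
  | nil =>
    have : x = y := hξ
    simp [this]
  | cons e ξ ih =>
    obtain ⟨rfl, h2⟩ := hξ
    rw [List.map_cons, List.sum_cons, ih h2 fun d hd => hu d (List.mem_cons_of_mem _ hd),
      hu e List.mem_cons_self]
    ring

theorem le_sum_of_isPath {ξ : List E} (hξ : Γ.IsPath ξ x y)
    (hu : ∀ e, u (Γ.arc e 1) ≤ u (Γ.arc e 0) + l e) : u y - u x ≤ (ξ.map l).sum := by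
  induction ξ generalizing x with
  | nil =>
    have : x = y := hξ
    simp [this]
  | cons e ξ ih =>
    obtain ⟨rfl, h2⟩ := hξ
    rw [List.map_cons, List.sum_cons]
    linarith [ih h2, hu e]

/-- The inequalities telescope, so slack in one edge would make the sum exceed the potential
difference. -/
theorem eq_of_sum_le_of_isPath {ξ : List E} (hξ : Γ.IsPath ξ x y)
    (hu : ∀ e, u (Γ.arc e 1) ≤ u (Γ.arc e 0) + l e) (hs : (ξ.map l).sum ≤ u y - u x) :
    ∀ e ∈ ξ, u (Γ.arc e 1) = u (Γ.arc e 0) + l e := by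
  induction ξ generalizing x with
  | nil => simp
  | cons e ξ ih =>
    obtain ⟨rfl, h2⟩ := hξ
    rw [List.map_cons, List.sum_cons] at hs
    have h3 := le_sum_of_isPath h2 hu
    rintro d (_ | ⟨_, hd⟩)
    · exact (hu e).antisymm (by linarith)
    · exact ih h2 (by linarith [hu e]) d hd

theorem IsPath.exists_pred {ξ : List E} (hξ : Γ.IsPath ξ x y) {e : E} (he : e ∈ ξ) :
    Γ.arc e 0 = x ∨ ∃ d ∈ ξ, Γ.arc d 1 = Γ.arc e 0 := by
  induction ξ generalizing x with
  | nil => simp at he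
  | cons d ξ ih =>
    obtain ⟨hd, h2⟩ := hξ
    rcases List.mem_cons.1 he with rfl | he
    · exact Or.inl hd
    · rcases ih h2 he with h | ⟨c, hc, h⟩
      · exact Or.inr ⟨d, List.mem_cons_self, h.symm⟩
      · exact Or.inr ⟨c, List.mem_cons_of_mem _ hc, h⟩

theorem IsPath.exists_last {ξ : List E} (hξ : Γ.IsPath ξ x y) (hne : ξ ≠ []) :
    ∃ d ∈ ξ, Γ.arc d 1 = y := by
  induction ξ generalizing x with
  | nil => exact absurd rfl hne
  | cons d ξ ih =>
    obtain ⟨-, h2⟩ := hξ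
    by_cases h : ξ = []
    · subst h
      exact ⟨d, List.mem_cons_self, h2⟩
    · obtain ⟨c, hc, h⟩ := ih h2 h
      exact ⟨c, List.mem_cons_of_mem _ hc, h⟩

theorem IsCycle.exists_pred {ξ : List E} (hξ : Γ.IsCycle ξ) {e : E} (he : e ∈ ξ) :
    ∃ d ∈ ξ, Γ.arc d 1 = Γ.arc e 0 := by
  obtain ⟨hne, x, hx⟩ := hξ
  rcases IsPath.exists_pred hx he with h | h
  · rw [h]
    exact IsPath.exists_last hx hne
  · exact h

/-- If no cycle has zero length, then a potential can be made strict. -/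
theorem exists_strict_potential [Finite E] (hl : ∀ ξ, Γ.IsCycle ξ → (ξ.map l).sum ≠ 0)
    (hu : ∀ e, u (Γ.arc e 1) ≤ u (Γ.arc e 0) + l e) :
    ∃ v : EuclideanSpace ℝ (Fin N) → ℝ, ∀ e, v (Γ.arc e 1) < v (Γ.arc e 0) + l e := by
  classical
  have := Fintype.ofFinite E
  induction hn : {e | u (Γ.arc e 1) = u (Γ.arc e 0) + l e}.ncard using Nat.strong_induction_on
    generalizing u with
  | _ n ih =>
  set B : Set E := {e | u (Γ.arc e 1) = u (Γ.arc e 0) + l e} with hB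
  by_cases hBne : B.Nonempty
  swap
  · exact ⟨u, fun e => (hu e).lt_of_ne fun he => hBne ⟨e, he⟩⟩
  -- Some saturated edge has no saturated predecessor, as otherwise a zero cycle appears. All edges
  -- into its origin then have slack, so raising the potential there makes this edge strict and
  -- saturates no new one; induct on the number of saturated edges.
  obtain ⟨e, heB, he⟩ : ∃ e ∈ B, ∀ d ∈ B, Γ.arc d 1 ≠ Γ.arc e 0 := by
    by_contra! hcon
    obtain ⟨ξ, hξ, hξB⟩ := exists_isCycle_of_forall_exists_pred hBne hcon
    refine hl ξ hξ ?_
    obtain ⟨-, x, hx⟩ := hξ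
    rw [sum_eq_of_isPath hx hξB, sub_self]
  set x := Γ.arc e 0
  have hgap : ∀ d, ∃ η > 0, Γ.arc d 1 = x → u x + η < u (Γ.arc d 0) + l d := by
    intro d
    by_cases hd : Γ.arc d 1 = x
    · have h1 : u x < u (Γ.arc d 0) + l d := by
        have := (hu d).lt_of_ne fun h => he d h hd
        rwa [hd] at this
      exact ⟨(u (Γ.arc d 0) + l d - u x) / 2, by linarith, fun _ => by linarith⟩
    · exact ⟨1, one_pos, fun h => absurd h hd⟩
  choose η hη0 hη using hgap
  have hE : Nonempty E := ⟨e⟩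
  obtain ⟨ε, hε0, hε⟩ : ∃ ε > 0, ∀ d, ε ≤ η d :=
    ⟨Finset.univ.inf' Finset.univ_nonempty η, (Finset.lt_inf'_iff _).2 fun d _ => hη0 d,
      fun d => Finset.inf'_le _ (Finset.mem_univ d)⟩
  set v : EuclideanSpace ℝ (Fin N) → ℝ := fun z => if z = x then u z + ε else u z with hv
  have hvx : v x = u x + ε := if_pos rfl
  have hvne : ∀ z, z ≠ x → v z = u z := fun z hz => if_neg hz
  have key : ∀ d, v (Γ.arc d 1) ≤ v (Γ.arc d 0) + l d ∧
      (v (Γ.arc d 1) = v (Γ.arc d 0) + l d →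
        u (Γ.arc d 1) = u (Γ.arc d 0) + l d ∧ Γ.arc d 0 ≠ x) := by
    intro d
    have h1 := hu d
    have h3 := he d
    by_cases hd1 : Γ.arc d 1 = x <;> by_cases hd0 : Γ.arc d 0 = x
    · rw [hd1, hd0] at h1 ⊢
      refine ⟨by linarith, fun h => absurd hd1 (h3 ?_)⟩
      simp only [hB, mem_ofPred_eq, hd1, hd0]
      linarith
    · have h2 := hη d hd1
      have h4 := hε d
      rw [hd1, hvx, hvne _ hd0]
      exact ⟨by linarith, fun h => by linarith⟩
    · rw [hd0, hvx, hvne _ hd1]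
      rw [hd0] at h1
      exact ⟨by linarith, fun h => by linarith⟩
    · rw [hvne _ hd1, hvne _ hd0]
      exact ⟨h1, fun h => ⟨h, hd0⟩⟩
  refine ih _ ?_ (fun d => (key d).1) rfl
  rw [← hn]
  refine ncard_lt_ncard ⟨fun d hd => ((key d).2 hd).1, fun hsub => ?_⟩ (toFinite _)
  exact ((key e).2 (hsub heB)).2 rfl

end EmbeddedNetwork

namespace NetworkHamiltonian

variable {N : ℕ} {E : Type*} {Γ : EmbeddedNetwork N E} {𝓗 : NetworkHamiltonian Γ}
  {a b r s t : ℝ} {e : E} {w : ℝ → ℝ} {u : EuclideanSpace ℝ (Fin N) → ℝ}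

/-! ### The levels `a_γ`, `c_γ` and `a₀` -/

theorem exists_H_eq_minH (hs : s ∈ Icc (0 : ℝ) 1) :
    ∃ p, 𝓗.H e s p = 𝓗.minH e s ∧ ∀ q, 𝓗.minH e s ≤ 𝓗.H e s q := by
  obtain ⟨p, hp⟩ := (continuous_slice hs).exists_forall_le (𝓗.coercive_H e s hs)
  have h1 : 𝓗.H e s p = 𝓗.minH e s :=
    (le_ciInf hp).antisymm (ciInf_le ⟨_, forall_mem_range.2 hp⟩ p)
  exact ⟨p, h1, fun q => h1 ▸ hp q⟩

theorem exists_H_zero_le (e : E) : ∃ M, ∀ s ∈ Icc (0 : ℝ) 1, 𝓗.H e s 0 ≤ M := by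
  have := (𝓗.continuousOn_H e).comp (f := fun t : ℝ => (t, (0 : ℝ))) (s := Icc 0 1)
    (by fun_prop) (fun t ht => ⟨ht, trivial⟩)
  obtain ⟨M, hM⟩ := isCompact_Icc.bddAbove_image this
  exact ⟨M, fun s hs => hM ⟨s, hs, rfl⟩⟩

theorem minH_le_aArc (hs : s ∈ Icc (0 : ℝ) 1) : 𝓗.minH e s ≤ 𝓗.aArc e := by
  obtain ⟨M, hM⟩ := 𝓗.exists_H_zero_le e
  refine le_csSup ⟨M, ?_⟩ ⟨s, hs, rfl⟩
  rintro _ ⟨t, ht, rfl⟩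
  obtain ⟨p, -, hp⟩ := 𝓗.exists_H_eq_minH (e := e) ht
  exact (hp 0).trans (hM t ht)

theorem levelNonempty_of_aArc_le (h : 𝓗.aArc e ≤ a) : 𝓗.LevelNonempty a e := fun s hs => by
  obtain ⟨p, hp, -⟩ := 𝓗.exists_H_eq_minH (e := e) hs
  exact ⟨p, hp.le.trans ((minH_le_aArc hs).trans h)⟩

/-- Two outer points at which `H > m`, with a point between them at which `H < m`, persist near `s`.
By quasiconvexity they confine the `m`-sublevel to a fixed compact interval, where continuity is
uniform. -/
theorem eventually_forall_lt_H (hs : s ∈ Icc (0 : ℝ) 1) (h : ∀ p, b < 𝓗.H e s p) :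
    ∀ᶠ t in 𝓝[Icc 0 1] s, ∀ p, b < 𝓗.H e t p := by
  obtain ⟨p₀, hp₀, -⟩ := 𝓗.exists_H_eq_minH (e := e) hs
  set m := 𝓗.minH e s + 1 with hm
  have hco := 𝓗.coercive_H e s hs
  rw [cocompact_eq_atBot_atTop, tendsto_sup] at hco
  obtain ⟨R, hR, hpR⟩ := ((hco.2.eventually_gt_atTop m).and (eventually_gt_atTop p₀)).exists
  obtain ⟨R', hR', hpR'⟩ := ((hco.1.eventually_gt_atTop m).and (eventually_lt_atBot p₀)).exists
  have hbm : b < m := by have := h p₀; linarith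
  have hK : ∀ᶠ t in 𝓝[Icc 0 1] s, ∀ p ∈ Icc R' R, b < 𝓗.H e t p := by
    have hcont : Continuous fun z : ℝ × ℝ =>
        𝓗.H e (projIcc 0 1 zero_le_one z.1) z.2 :=
      (𝓗.continuousOn_H e).comp_continuous
        (f := fun z : ℝ × ℝ => ((projIcc (0 : ℝ) 1 zero_le_one z.1 : ℝ), z.2)) (by fun_prop)
        fun z => ⟨(projIcc _ _ zero_le_one z.1).2, trivial⟩
    have hev := (isCompact_Icc (a := R') (b := R)).eventually_forall_of_forall_eventually
      (x₀ := s) (P := fun t p => b < 𝓗.H e (projIcc 0 1 zero_le_one t) p) fun p _ => by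
        refine hcont.continuousAt.eventually_const_lt ?_
        simp only
        rw [projIcc_of_mem _ hs]
        exact h p
    filter_upwards [nhdsWithin_le_nhds hev, self_mem_nhdsWithin] with t ht htI
    rwa [projIcc_of_mem _ htI] at ht
  filter_upwards [hK, self_mem_nhdsWithin, eventually_lt_slice hs hR, eventually_lt_slice hs hR',
    eventually_slice_lt hs (hp₀.trans_lt (lt_add_one _))] with t h1 ht h2 h3 h4 p
  by_contra! hp
  have hq := 𝓗.quasiconvex_H e t ht
  have h5 := hq.lt_of_level_lt hpR h4.le h2 (hp.trans hbm.le)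
  have h6 := hq.gt_of_level_lt hpR' h4.le h3 (hp.trans hbm.le)
  exact absurd (h1 p ⟨h6.le, h5.le⟩) (not_lt.2 hp)

/-- If the minimum exceeded `b` at `s`, it would do so on an interval around an interior point `q`,
yet a steep parabola touches `w` from above somewhere in that interval. -/
theorem minH_le_of_isPeriodicSubsolution (hw : IsPeriodicSubsolution (𝓗.H e) b w)
    (hs : s ∈ Icc (0 : ℝ) 1) : 𝓗.minH e s ≤ b := by
  by_contra! hlt
  have h1 : ∀ᶠ t in 𝓝[Icc 0 1] s, ∀ p, b < 𝓗.H e t p := by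
    obtain ⟨p, -, hp⟩ := 𝓗.exists_H_eq_minH (e := e) hs
    exact eventually_forall_lt_H hs fun q => hlt.trans_le (hp q)
  obtain ⟨q, hq, hqI⟩ : ∃ q, (∀ p, b < 𝓗.H e q p) ∧ q ∈ Ioo (0 : ℝ) 1 := by
    have : (𝓝[Ioo (0 : ℝ) 1] s).NeBot := by
      rw [← mem_closure_iff_nhdsWithin_neBot, closure_Ioo zero_ne_one]
      exact hs
    exact ((h1.filter_mono (nhdsWithin_mono _ Ioo_subset_Icc_self)).and
      self_mem_nhdsWithin).exists
  have hev : ∀ᶠ t in 𝓝 q, (∀ p, b < 𝓗.H e t p) ∧ t ∈ Ioo (0 : ℝ) 1 := by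
    have h2 := eventually_forall_lt_H (Ioo_subset_Icc_self hqI) hq
    rw [nhdsWithin_eq_nhds.2 (Icc_mem_nhds hqI.1 hqI.2)] at h2
    exact h2.and (Ioo_mem_nhds hqI.1 hqI.2)
  obtain ⟨δ, hδ0, hδ⟩ := Metric.nhds_basis_closedBall.mem_iff.1 hev
  rw [Real.closedBall_eq_Icc] at hδ
  have hle : q - δ ≤ q + δ := by linarith
  -- The penalty at `q ± δ` exceeds the rise of `w` from `q`, so the maximum is interior.
  set K := (|w (q + δ) - w q| + |w (q - δ) - w q| + 1) / δ ^ 2 with hK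
  have hKδ : K * δ ^ 2 = |w (q + δ) - w q| + |w (q - δ) - w q| + 1 := by
    rw [hK]; field_simp
  set φ : ℝ → ℝ := fun x => K * (x - q) ^ 2 with hφ
  have hφC : ContDiff ℝ 1 φ := by simp only [hφ]; fun_prop
  obtain ⟨m, hm, hmax⟩ := isCompact_Icc.exists_isMaxOn (nonempty_Icc.2 hle)
    ((hw.1.mono fun x hx => Ioo_subset_Icc_self (hδ hx).2).sub hφC.continuous.continuousOn)
  have hmq := hmax (⟨by linarith, by linarith⟩ : q ∈ Icc (q - δ) (q + δ))
  simp only [mem_ofPred_eq, Pi.sub_apply, hφ, sub_self] at hmq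
  have hm1 : m ≠ q - δ := by
    rintro rfl
    have h3 : K * (q - δ - q) ^ 2 = K * δ ^ 2 := by ring
    rw [h3, hKδ] at hmq
    have h4 := le_abs_self (w (q - δ) - w q)
    have h5 := abs_nonneg (w (q + δ) - w q)
    linarith
  have hm2 : m ≠ q + δ := by
    rintro rfl
    have h3 : K * (q + δ - q) ^ 2 = K * δ ^ 2 := by ring
    rw [h3, hKδ] at hmq
    have h4 := le_abs_self (w (q + δ) - w q)
    have h5 := abs_nonneg (w (q - δ) - w q)
    linarith
  have := hw.2.1 m (hδ hm).2 (fun x => φ x + (w m - φ m)) (hφC.add contDiff_const) (by ring) (by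
    filter_upwards [Icc_mem_nhds (hm.1.lt_of_ne hm1.symm) (hm.2.lt_of_ne hm2)] with x hx
    have := hmax hx
    simp only [mem_ofPred_eq, Pi.sub_apply] at this
    linarith)
  exact absurd ((hδ hm).1 _) (not_lt.2 this)

theorem bddBelow_periodicSubsolution (e : E) :
    BddBelow {a | ∃ w, IsPeriodicSubsolution (𝓗.H e) a w} := by
  refine ⟨𝓗.minH e 0, ?_⟩
  rintro b ⟨w, hw⟩
  exact minH_le_of_isPeriodicSubsolution hw ⟨le_rfl, zero_le_one⟩

theorem aArc_le_cArc (e : E) : 𝓗.aArc e ≤ 𝓗.cArc e := by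
  refine csSup_le ((nonempty_Icc.2 zero_le_one).image _) ?_
  rintro _ ⟨s, hs, rfl⟩
  refine le_csInf ?_ ?_
  -- Constants are subsolutions at a high level, so the infimum defining `cArc` is over a nonempty
  -- set.
  · obtain ⟨M, hM⟩ := 𝓗.exists_H_zero_le e
    refine ⟨M, fun _ => 0, continuousOn_const, fun s hs φ hφ hφs hle => ?_, rfl⟩
    have hmin : IsLocalMin φ s := by
      filter_upwards [hle] with t ht
      rwa [hφs]
    rw [hmin.deriv_eq_zero]
    exact hM s (Ioo_subset_Icc_self hs)
  · rintro b ⟨w, hw⟩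
    exact minH_le_of_isPeriodicSubsolution hw hs

theorem aArc_le_a₀ [Finite E] (e : E) : 𝓗.aArc e ≤ 𝓗.a₀ := by
  classical
  have h := le_ciSup (f := fun e => if Γ.arc e 0 = Γ.arc e 1 then 𝓗.cArc e else 𝓗.aArc e)
    (finite_range _).bddAbove e
  refine le_trans ?_ h
  split_ifs
  · exact aArc_le_cArc e
  · exact le_rfl

theorem levelNonempty_of_a₀_le [Finite E] (h : 𝓗.a₀ ≤ a) (e : E) : 𝓗.LevelNonempty a e :=
  levelNonempty_of_aArc_le ((aArc_le_a₀ e).trans h)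

theorem aArc_eq_of_forall_minH_eq {m : ℝ} (hm : ∀ s ∈ Icc (0 : ℝ) 1, 𝓗.minH e s = m) :
    𝓗.aArc e = m := by
  have : 𝓗.minH e '' Icc 0 1 = {m} := by
    rw [image_congr hm, (nonempty_Icc.2 zero_le_one).image_const]
  rw [aArc, this, csSup_singleton]

theorem le_H_of_aArc_eq (h𝓗 : 𝓗.ConstantMinOnExtremalArcs) (he : 𝓗.aArc e = 𝓗.a₀)
    (hs : s ∈ Icc (0 : ℝ) 1) (p : ℝ) : 𝓗.a₀ ≤ 𝓗.H e s p := by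
  obtain ⟨m, hm⟩ := h𝓗 e he
  obtain ⟨-, -, hp⟩ := 𝓗.exists_H_eq_minH (e := e) hs
  rw [← he, aArc_eq_of_forall_minH_eq hm, ← hm s hs]
  exact hp p

/-- Above the level `a₀` the sublevels on an arc are either all nondegenerate or all minimal. -/
theorem forall_exists_H_lt_or_forall_le_H [Finite E] (h𝓗 : 𝓗.ConstantMinOnExtremalArcs)
    (ha : 𝓗.a₀ ≤ a) (e : E) : (∀ s ∈ Icc (0 : ℝ) 1, ∃ p, 𝓗.H e s p < a) ∨
      ∀ s ∈ Icc (0 : ℝ) 1, ∀ p, a ≤ 𝓗.H e s p := by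
  rcases ((aArc_le_a₀ e).trans ha).lt_or_eq with hlt | heq
  · refine Or.inl fun s hs => ?_
    obtain ⟨p, hp, -⟩ := 𝓗.exists_H_eq_minH (e := e) hs
    exact ⟨p, hp.trans_lt ((minH_le_aArc hs).trans_lt hlt)⟩
  · have h0 : 𝓗.a₀ = a := ha.antisymm (heq ▸ aArc_le_a₀ e)
    refine Or.inr fun s hs p => ?_
    rw [← h0]
    exact le_H_of_aArc_eq h𝓗 (heq.trans h0.symm) hs p

/-! ### The critical value -/

theorem continuousOn_prim_level (h : 𝓗.LevelNonempty a e) (t : ℝ) :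
    ContinuousOn (fun b => 𝓗.prim b e t) (Ici a) := by
  intro b hb
  have hb1 : b ≤ b + 1 := by linarith
  have h1 := continuous_sigmaPlus_proj h
  have h2 := continuous_sigmaPlus_proj (h.mono (hb.trans hb1))
  refine intervalIntegral.continuousWithinAt_of_dominated_interval
    (bound := fun x => |𝓗.sigmaPlus a e (projIcc 0 1 zero_le_one x)| +
      |𝓗.sigmaPlus (b + 1) e (projIcc 0 1 zero_le_one x)|) ?_ ?_
    ((h1.abs.add h2.abs).intervalIntegrable _ _) ?_
  · filter_upwards [self_mem_nhdsWithin] with c hc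
    exact (continuous_sigmaPlus_proj (h.mono hc)).aestronglyMeasurable
  · filter_upwards [self_mem_nhdsWithin, nhdsWithin_le_nhds (gt_mem_nhds (lt_add_one b))]
      with c hc hcb
    refine MeasureTheory.ae_of_all _ fun x _ => ?_
    have hx := (projIcc (0 : ℝ) 1 zero_le_one x).2
    have h3 := sigmaPlus_mono h hx hc
    have h4 := sigmaPlus_mono (h.mono hc) hx (le_of_lt hcb)
    rw [Real.norm_eq_abs, abs_le]
    have h5 := neg_abs_le (𝓗.sigmaPlus a e (projIcc 0 1 zero_le_one x))
    have h6 := le_abs_self (𝓗.sigmaPlus (b + 1) e (projIcc 0 1 zero_le_one x))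
    have h7 := abs_nonneg (𝓗.sigmaPlus a e (projIcc 0 1 zero_le_one x))
    have h8 := abs_nonneg (𝓗.sigmaPlus (b + 1) e (projIcc 0 1 zero_le_one x))
    constructor <;> linarith
  · exact MeasureTheory.ae_of_all _ fun x _ => continuousOn_sigmaPlus_level h (projIcc _ _ _ x).2 b hb

theorem continuousOn_sigma_level (h : 𝓗.LevelNonempty a e) :
    ContinuousOn (fun b => 𝓗.sigma b e) (Ici a) :=
  ((continuousOn_prim_level h 1).sub (continuousOn_prim_level h 0)).congr
    fun _ hb => sigma_eq (h.mono hb)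

theorem continuousOn_curveLength_level (h : ∀ e, 𝓗.LevelNonempty a e)
    (ξ : List (ArcPortion E)) : ContinuousOn (fun b => 𝓗.curveLength b ξ) (Ici a) := by
  induction ξ with
  | nil => simpa [curveLength] using continuousOn_const
  | cons p ξ ih =>
    have hp : ContinuousOn (fun b => 𝓗.portionLength b p) (Ici a) :=
      ((continuousOn_prim_level (h p.edge) p.s₂).sub
        (continuousOn_prim_level (h p.edge) p.s₁)).congr fun b hb =>
          portionLength_eq ((h p.edge).mono hb) p.zero_le p.le p.le_one
    refine (hp.add ih).congr fun b _ => ?_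
    simp [curveLength]

theorem sigma_mono (h : 𝓗.LevelNonempty a e) (hab : a ≤ b) : 𝓗.sigma a e ≤ 𝓗.sigma b e := by
  refine intervalIntegral.integral_mono_on zero_le_one ?_ ?_
    fun s hs => sigmaPlus_mono h hs hab
  · refine ContinuousOn.intervalIntegrable ?_
    rw [uIcc_of_le zero_le_one]; exact continuousOn_sigmaPlus h
  · refine ContinuousOn.intervalIntegrable ?_
    rw [uIcc_of_le zero_le_one]; exact continuousOn_sigmaPlus (h.mono hab)

theorem sigma_lt (h : 𝓗.LevelNonempty a e) (hab : a < b) : 𝓗.sigma a e < 𝓗.sigma b e :=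
  intervalIntegral.integral_lt_integral_of_continuousOn_of_le_of_exists_lt zero_lt_one
    (continuousOn_sigmaPlus h) (continuousOn_sigmaPlus (h.mono hab.le))
    (fun _ hs => sigmaPlus_mono h (Ioc_subset_Icc_self hs) hab.le)
    ⟨0, ⟨le_rfl, zero_le_one⟩, sigmaPlus_lt_of_lt h ⟨le_rfl, zero_le_one⟩ hab⟩

theorem isDiscreteSubsolution_iff : 𝓗.IsDiscreteSubsolution a u ↔
    ∀ e, u (Γ.arc e 1) ≤ u (Γ.arc e 0) + 𝓗.sigma a e := by
  constructor
  · intro hu e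
    have := hu _ (Γ.arc_one_mem_vertices e) (Γ.rev e) (Γ.arc_rev_zero)
    rwa [Γ.arc_rev_one, Γ.rev_rev] at this
  · rintro hu x - e rfl
    have := hu (Γ.rev e)
    rwa [Γ.arc_rev_one, Γ.arc_rev_zero] at this

theorem IsDiscreteSubsolution.exists_isSub (hu : 𝓗.IsDiscreteSubsolution a u)
    (h : ∀ e, 𝓗.LevelNonempty a e) : ∃ f, 𝓗.IsSub a f := by
  rw [isDiscreteSubsolution_iff] at hu
  obtain ⟨f, hf, -⟩ := exists_isSub_extension h (subset_refl Γ.vertices) (v := u)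
    fun e s hs t ht hsV htV => by
      rcases Γ.eq_zero_or_one_of_mem_vertices hs hsV with rfl | rfl <;>
      rcases Γ.eq_zero_or_one_of_mem_vertices ht htV with rfl | rfl
      · simp [arcDist_self]
      · rw [arcDist_of_le (h e) zero_le_one, ← sigma_eq (h e)]
        linarith [hu e]
      · have := hu (Γ.rev e)
        rw [Γ.arc_rev_one, Γ.arc_rev_zero, sigma_eq (h _)] at this
        rw [arcDist_of_ge (h e) zero_le_one]
        simp only [primMinus, sub_zero, sub_self]
        linarith
      · simp [arcDist_self]
  exact ⟨f, hf⟩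

theorem bddBelow_criticalValue :
    BddBelow {a | 𝓗.a₀ ≤ a ∧ ∃ u, 𝓗.IsDiscreteSubsolution a u} := ⟨𝓗.a₀, fun _ h => h.1⟩

theorem nonempty_criticalValue [Finite E] :
    {a | 𝓗.a₀ ≤ a ∧ ∃ u, 𝓗.IsDiscreteSubsolution a u}.Nonempty := by
  choose M hM using 𝓗.exists_H_zero_le
  obtain ⟨B, hB⟩ := (finite_range M).bddAbove
  refine ⟨max 𝓗.a₀ B, le_max_left _ _, fun _ => 0, isDiscreteSubsolution_iff.2 fun e => ?_⟩
  rw [zero_add]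
  refine intervalIntegral.integral_nonneg zero_le_one fun s hs => le_sigmaPlus hs ?_
  exact (hM e s hs).trans ((hB ⟨e, rfl⟩).trans (le_max_right _ _))

theorem a₀_le_criticalValue [Finite E] : 𝓗.a₀ ≤ 𝓗.criticalValue :=
  le_csInf nonempty_criticalValue fun _ h => h.1

theorem levelNonempty_of_criticalValue_le [Finite E] (ha : 𝓗.criticalValue ≤ a) (e : E) :
    𝓗.LevelNonempty a e :=
  levelNonempty_of_a₀_le (a₀_le_criticalValue.trans ha) e

/-- Strictly above the critical value a discrete subsolution is inherited from a lower level and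
extends to the network. The critical level itself follows because the length of a fixed curve is
continuous in the level, so attainment of the infimum is not presupposed. -/
theorem closedCurvesNonneg_of_criticalValue_le [Finite E] (ha : 𝓗.criticalValue ≤ a) :
    𝓗.ClosedCurvesNonneg a := by
  have hlt : ∀ b, 𝓗.criticalValue < b → 𝓗.ClosedCurvesNonneg b := by
    intro b hb
    obtain ⟨a', ⟨ha', u, hu⟩, hab⟩ := exists_lt_of_csInf_lt nonempty_criticalValue hb
    have hub : 𝓗.IsDiscreteSubsolution b u := isDiscreteSubsolution_iff.2 fun e => by
      linarith [isDiscreteSubsolution_iff.1 hu e,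
        sigma_mono (levelNonempty_of_a₀_le ha' e) hab.le]
    have hLb := levelNonempty_of_criticalValue_le hb.le
    obtain ⟨f, hf⟩ := hub.exists_isSub hLb
    exact hf.closedCurvesNonneg hLb
  intro ξ x hξ
  have hcont := (continuousOn_curveLength_level (levelNonempty_of_criticalValue_le ha) ξ) a
    self_mem_Ici
  refine ge_of_tendsto (hcont.mono_left (nhdsWithin_mono a Ioi_subset_Ici_self)) ?_
  filter_upwards [self_mem_nhdsWithin] with b hb
  exact hlt b (ha.trans_lt hb) ξ x hξ

theorem IsSub.le_sigma {f : EuclideanSpace ℝ (Fin N) → ℝ} (hf : 𝓗.IsSub a f)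
    (h : ∀ e, 𝓗.LevelNonempty a e) (e : E) :
    f (Γ.arc e 1) ≤ f (Γ.arc e 0) + 𝓗.sigma a e := by
  rw [sigma_eq (h e)]
  linarith [hf e 0 1 le_rfl zero_le_one le_rfl]

theorem exists_isSub_of_criticalValue_le [Finite E] [Nonempty E] (ha : 𝓗.criticalValue ≤ a) :
    ∃ f, 𝓗.IsSub a f := by
  obtain ⟨e⟩ := ‹Nonempty E›
  exact ⟨_, (closedCurvesNonneg_of_criticalValue_le ha).isSub_semidistance
    (levelNonempty_of_criticalValue_le ha)
    (Γ.vertices_subset_support (Γ.arc_zero_mem_vertices e))⟩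

theorem sum_sigma_nonneg [Finite E] [Nonempty E] (ha : 𝓗.criticalValue ≤ a) {ξ : List E}
    (hξ : Γ.IsCycle ξ) : 0 ≤ (ξ.map (𝓗.sigma a)).sum := by
  obtain ⟨f, hf⟩ := 𝓗.exists_isSub_of_criticalValue_le ha
  obtain ⟨-, x, hx⟩ := hξ
  have := EmbeddedNetwork.le_sum_of_isPath hx (hf.le_sigma (levelNonempty_of_criticalValue_le ha))
  linarith

theorem sum_sigma_pos [Finite E] [Nonempty E] (ha : 𝓗.criticalValue < a) {ξ : List E}
    (hξ : Γ.IsCycle ξ) : 0 < (ξ.map (𝓗.sigma a)).sum := by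
  refine (𝓗.sum_sigma_nonneg le_rfl hξ).trans_lt ?_
  obtain ⟨hne, -⟩ := hξ
  exact List.sum_lt_sum_of_ne_nil hne _ _ fun e _ =>
    sigma_lt (levelNonempty_of_criticalValue_le le_rfl e) ha

theorem sigma_add_sigma_rev (h : 𝓗.LevelNonempty a e)
    (hmin : ∀ s ∈ Icc (0 : ℝ) 1, ∀ p, a ≤ 𝓗.H e s p) :
    𝓗.sigma a e + 𝓗.sigma a (Γ.rev e) = 0 := by
  have := prim_sub_eq_primMinus_sub h hmin 0 1
  rw [sigma_eq h, sigma_eq h.rev, this]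
  simp [primMinus]

/-- Over the arc `prim` gains `P` and `primMinus` loses `M`, both positive. The convex combination
with weights proportional to `M` and `P` has zero total increment and its slope stays in the
sublevel interval. -/
theorem isPeriodicSubsolution_of_sigma_pos (h : 𝓗.LevelNonempty b e) (h1 : 0 < 𝓗.sigma b e)
    (h2 : 0 < 𝓗.sigma b (Γ.rev e)) : ∃ w, IsPeriodicSubsolution (𝓗.H e) b w := by
  rw [sigma_eq h] at h1
  rw [sigma_eq h.rev] at h2
  set P := 𝓗.prim b e 1 - 𝓗.prim b e 0 with hP
  set M := 𝓗.prim b (Γ.rev e) 1 - 𝓗.prim b (Γ.rev e) 0 with hM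
  have hPM : 0 < P + M := add_pos h1 h2
  refine ⟨fun t => M / (P + M) * 𝓗.prim b e t + P / (P + M) * 𝓗.primMinus b e t,
    ?_, fun s hs φ hφ hφs hle => ?_, ?_⟩
  · have := continuous_prim h
    have := continuous_primMinus h
    exact Continuous.continuousOn (by fun_prop)
  · have hs' := Ioo_subset_Icc_self hs
    have hd : HasDerivAt φ (deriv φ s) s := (hφ.differentiable one_ne_zero s).hasDerivAt
    have hmin : IsLocalMin (φ - fun t => M / (P + M) * 𝓗.prim b e t +
        P / (P + M) * 𝓗.primMinus b e t) s := by
      filter_upwards [hle] with t ht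
      simp only [Pi.sub_apply]
      linarith
    have := hmin.hasDerivAt_eq_zero (hd.sub
      (((hasDerivAt_prim_of_mem h hs').const_mul _).add
        ((hasDerivAt_primMinus_of_mem h hs').const_mul _)))
    rw [sub_eq_zero.1 this]
    have hσ := sigmaMinus_le_sigmaPlus h hs'
    refine H_le_of_mem h hs' ?_
    rw [← segment_eq_Icc hσ]
    refine ⟨P / (P + M), M / (P + M), by positivity, by positivity, by field_simp, ?_⟩
    simp only [smul_eq_mul]
    ring
  · have hM' : M = 𝓗.primMinus b e 0 - 𝓗.primMinus b e 1 := by simp [primMinus, hM]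
    have : M / (P + M) * P - P / (P + M) * M = 0 := by ring
    simp only
    nth_rewrite 2 [hP] at this
    nth_rewrite 4 [hM'] at this
    linarith

/-- If the critical value is `a₀`, take an arc realizing `a₀`. When its `aArc` is `a₀`, the arc
followed by its inverse has zero length. Otherwise it is a loop realizing `cArc`: were both
orientations of positive length, this would persist slightly below, giving periodic subsolutions
below `cArc`. If the critical value exceeds `a₀` and there is no zero cycle, a strict potential
survives at slightly lower levels, against minimality. -/
theorem nonempty_aubryEdges [Finite E] [Nonempty E] (h𝓗 : 𝓗.ConstantMinOnExtremalArcs) :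
    𝓗.aubryEdges.Nonempty := by
  classical
  set c := 𝓗.criticalValue with hc
  have hL : ∀ e, 𝓗.LevelNonempty c e := levelNonempty_of_criticalValue_le le_rfl
  rcases (a₀_le_criticalValue (𝓗 := 𝓗)).eq_or_lt with h0 | h0
  · obtain ⟨e, he⟩ := exists_eq_ciSup_of_finite
      (f := fun e => if Γ.arc e 0 = Γ.arc e 1 then 𝓗.cArc e else 𝓗.aArc e)
    change _ = 𝓗.a₀ at he
    by_cases hea : 𝓗.aArc e = 𝓗.a₀
    · refine ⟨e, [e, Γ.rev e], ⟨by simp, Γ.arc e 0, rfl, Γ.arc_rev_zero, Γ.arc_rev_one⟩, ?_,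
        by simp⟩
      have := sigma_add_sigma_rev (hL e) fun s hs p => by
        rw [hc, ← h0]; exact le_H_of_aArc_eq h𝓗 hea hs p
      simpa using this
    · by_cases hcl : Γ.arc e 0 = Γ.arc e 1
      swap
      · simp only [hcl, if_false] at he
        exact absurd he hea
      simp only [hcl, if_true] at he
      have hlt : 𝓗.aArc e < c := ((aArc_le_a₀ e).lt_of_ne hea).trans_eq h0
      have hcyc : Γ.IsCycle [e] := ⟨by simp, Γ.arc e 0, rfl, hcl.symm⟩
      have hcyc' : Γ.IsCycle [Γ.rev e] :=
        ⟨by simp, Γ.arc e 1, Γ.arc_rev_zero, by rw [Γ.arc_rev_one, hcl]; rfl⟩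
      have h1 := 𝓗.sum_sigma_nonneg le_rfl hcyc
      have h2 := 𝓗.sum_sigma_nonneg le_rfl hcyc'
      by_cases h1' : 𝓗.sigma c e = 0
      · exact ⟨e, [e], hcyc, by simpa using h1', by simp⟩
      by_cases h2' : 𝓗.sigma c (Γ.rev e) = 0
      · exact ⟨Γ.rev e, [Γ.rev e], hcyc', by simpa using h2', by simp⟩
      exfalso
      simp only [List.map_cons, List.map_nil, List.sum_singleton] at h1 h2
      have hLe : 𝓗.LevelNonempty (𝓗.aArc e) e := levelNonempty_of_aArc_le le_rfl
      have hev : ∀ᶠ b in 𝓝[Ici (𝓗.aArc e)] c,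
          0 < 𝓗.sigma b e ∧ 0 < 𝓗.sigma b (Γ.rev e) :=
        ((continuousOn_sigma_level hLe c hlt.le).eventually_const_lt
          (lt_of_le_of_ne h1 (Ne.symm h1'))).and
        ((continuousOn_sigma_level hLe.rev c hlt.le).eventually_const_lt
          (lt_of_le_of_ne h2 (Ne.symm h2')))
      have hne : (𝓝[Ioo (𝓗.aArc e) c] c).NeBot := by
        rw [nhdsWithin_Ioo_eq_nhdsLT hlt]; infer_instance
      obtain ⟨b, ⟨hb1, hb2⟩, hb⟩ := ((hev.filter_mono (nhdsWithin_mono c (show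
        Ioo (𝓗.aArc e) c ⊆ Ici (𝓗.aArc e) from fun _ hx => hx.1.le))).and self_mem_nhdsWithin).exists
      have hcle : 𝓗.cArc e ≤ b := csInf_le (bddBelow_periodicSubsolution e)
        (isPeriodicSubsolution_of_sigma_pos (hLe.mono hb.1.le) hb1 hb2)
      linarith [hb.2]
  · by_contra hemp
    rw [not_nonempty_iff_eq_empty] at hemp
    obtain ⟨f, hf⟩ := 𝓗.exists_isSub_of_criticalValue_le le_rfl
    obtain ⟨v, hv⟩ := EmbeddedNetwork.exists_strict_potential (l := 𝓗.sigma c) (fun ξ hξ h => by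
      obtain ⟨e, he⟩ := List.exists_mem_of_ne_nil _ hξ.1
      have : e ∈ 𝓗.aubryEdges := ⟨ξ, hξ, h, he⟩
      rwa [hemp] at this) (hf.le_sigma hL)
    have hev : ∀ᶠ b in 𝓝[Ici 𝓗.a₀] c, ∀ e, v (Γ.arc e 1) - v (Γ.arc e 0) < 𝓗.sigma b e :=
      eventually_all.2 fun e => (continuousOn_sigma_level (levelNonempty_of_a₀_le le_rfl e)
        c h0.le).eventually_const_lt (by linarith [hv e])
    have hne : (𝓝[Ioo 𝓗.a₀ c] c).NeBot := by
      rw [nhdsWithin_Ioo_eq_nhdsLT h0]; infer_instance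
    obtain ⟨b, hb1, hb⟩ := ((hev.filter_mono (nhdsWithin_mono c (show
      Ioo 𝓗.a₀ c ⊆ Ici 𝓗.a₀ from fun _ hx => hx.1.le))).and self_mem_nhdsWithin).exists
    have : c ≤ b := csInf_le bddBelow_criticalValue
      ⟨hb.1.le, v, isDiscreteSubsolution_iff.2 fun e => by linarith [hb1 e]⟩
    linarith [hb.2]

end NetworkHamiltonian

namespace NetworkHamiltonian

variable {N : ℕ} {E : Type*} {Γ : EmbeddedNetwork N E} {𝓗 : NetworkHamiltonian Γ}
  {a r s t : ℝ} {e : E} {x y : EuclideanSpace ℝ (Fin N)}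
  {f g u : EuclideanSpace ℝ (Fin N) → ℝ} {Γ' U V : Set (EuclideanSpace ℝ (Fin N))}

/-! ### Uniqueness -/

theorem IsSolutionIn.mono (hu : 𝓗.IsSolutionIn a U u) (hVU : V ⊆ U) : 𝓗.IsSolutionIn a V u :=
  ⟨hu.1, fun e s hs h => hu.2.1 e s hs (hVU h), fun x hx => hu.2.2 x ⟨hx.1, hVU hx.2⟩⟩

/-- On a portion of an arc, admissibility of the trace covers the stretch between the first and last
points of `Γ'`, where the equation may fail; the two outer stretches miss `Γ'` and the viscosity
inequality integrates there. -/
theorem IsSolutionIn.isSub (hu : 𝓗.IsSolutionIn a (Γ.support \ Γ') u)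
    (hn : 𝓗.ClosedCurvesNonneg a) (h : ∀ e, 𝓗.LevelNonempty a e) (hΓ'c : IsClosed Γ')
    (hg : 𝓗.IsAdmissibleTrace a Γ' g) (hug : EqOn u g Γ') : 𝓗.IsSub a u := by
  have hgap : ∀ e s t, 0 ≤ s → s ≤ t → t ≤ 1 → (∀ r ∈ Ioo s t, Γ.arc e r ∉ Γ') →
      u (Γ.arc e t) - u (Γ.arc e s) ≤ 𝓗.prim a e t - 𝓗.prim a e s := by
    intro e s t hs hst ht hr
    refine sub_le_prim_of_isViscSubAt (w := fun r => u (Γ.arc e r)) (h e) hs hst ht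
      ((Γ.continuousOn_comp_arc hu.1 e).mono (Icc_subset_Icc hs ht)) fun r hr' => ?_
    have hI : r ∈ Ioo (0 : ℝ) 1 := ⟨hs.trans_lt hr'.1, hr'.2.trans_le ht⟩
    exact (hu.2.1 e r hI ⟨Γ.arc_mem_support (Ioo_subset_Icc_self hI), hr r hr'⟩).1
  intro e s t hs hst ht
  have hcomp : IsCompact (Icc s t ∩ {r | r ∈ Icc (0 : ℝ) 1 ∧ Γ.arc e r ∈ Γ'}) :=
    isCompact_Icc.inter (isCompact_arc_preimage e hΓ'c)
  by_cases hne : (Icc s t ∩ {r | r ∈ Icc (0 : ℝ) 1 ∧ Γ.arc e r ∈ Γ'}).Nonempty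
  swap
  · exact hgap e s t hs hst ht fun r hr hrΓ => hne ⟨r, Ioo_subset_Icc_self hr,
      ⟨hs.trans hr.1.le, hr.2.le.trans ht⟩, hrΓ⟩
  obtain ⟨s₁, ⟨hs₁, hs₁I, hs₁Γ⟩, hs₁min⟩ := hcomp.exists_isLeast hne
  obtain ⟨t₁, ⟨ht₁, ht₁I, ht₁Γ⟩, ht₁max⟩ := hcomp.exists_isGreatest hne
  have hst₁ : s₁ ≤ t₁ := hs₁min ⟨ht₁, ht₁I, ht₁Γ⟩
  have h1 := hgap e s s₁ hs hs₁.1 hs₁I.2 fun r hr hrΓ => not_lt.2 (hs₁min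
    ⟨⟨hr.1.le, hr.2.le.trans hs₁.2⟩, ⟨hs.trans hr.1.le, hr.2.le.trans hs₁I.2⟩, hrΓ⟩) hr.2
  have h2 := hgap e t₁ t ht₁I.1 ht₁.2 ht fun r hr hrΓ => not_lt.2 (ht₁max
    ⟨⟨ht₁.1.trans hr.1.le, hr.2.le⟩, ⟨ht₁I.1.trans hr.1.le, hr.2.le.trans ht⟩, hrΓ⟩) hr.1
  have h3 := hg _ ht₁Γ _ hs₁Γ
  have h4 := hn.semidistance_arc_le h hs₁I.1 hst₁ ht₁I.2 (e := e)
  rw [← hug ht₁Γ, ← hug hs₁Γ] at h3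
  linarith

/-- On a degenerate arc the forward and backward bounds are opposite, so the increments are forced.
-/
theorem IsSub.sub_eq_prim (hf : 𝓗.IsSub a f) (h : ∀ e, 𝓗.LevelNonempty a e)
    (hmin : ∀ s ∈ Icc (0 : ℝ) 1, ∀ p, a ≤ 𝓗.H e s p) (hs : 0 ≤ s) (hst : s ≤ t) (ht : t ≤ 1) :
    f (Γ.arc e t) - f (Γ.arc e s) = 𝓗.prim a e t - 𝓗.prim a e s := by
  refine (hf e s t hs hst ht).antisymm ?_
  have h1 := hf.le_arcDist h ⟨hs.trans hst, ht⟩ ⟨hs, hst.trans ht⟩ (e := e)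
  rw [arcDist_of_ge (h e) hst, ← prim_sub_eq_primMinus_sub (h e) hmin] at h1
  linarith

/-- At a vertex outside `Γ'` a solution is transported along an incoming arc. -/
theorem IsSolutionIn.exists_incoming (hu : 𝓗.IsSolutionIn a (Γ.support \ Γ') u)
    (hus : 𝓗.IsSub a u) (h : ∀ e, 𝓗.LevelNonempty a e)
    (hdich : ∀ e, (∀ s ∈ Icc (0 : ℝ) 1, ∃ p, 𝓗.H e s p < a) ∨
      ∀ s ∈ Icc (0 : ℝ) 1, ∀ p, a ≤ 𝓗.H e s p)
    (hΓ'c : IsClosed Γ') (hxV : x ∈ Γ.vertices) (hx : x ∉ Γ') :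
    ∃ e, Γ.arc e 1 = x ∧ ∃ α ∈ Ico (0 : ℝ) 1,
      (Γ.arc e α ∈ Γ' ∨ α = 0 ∧ ∀ t ∈ Icc (0 : ℝ) 1, Γ.arc e t ∉ Γ') ∧
      u x = u (Γ.arc e α) + (𝓗.prim a e 1 - 𝓗.prim a e α) := by
  obtain ⟨e, he, hsc⟩ := hu.2.2 x ⟨hxV, Γ.vertices_subset_support hxV, hx⟩
  have key : ∀ α ∈ Ico (0 : ℝ) 1, (∀ r ∈ Ioo α 1, Γ.arc e r ∉ Γ') →
      u x = u (Γ.arc e α) + (𝓗.prim a e 1 - 𝓗.prim a e α) := by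
    intro α hα hαΓ
    have h1 := hus e α 1 hα.1 hα.2.le le_rfl
    rw [he] at h1
    rcases hdich e with hst | hmin
    · have h2 := le_of_stateConstraintAtOne (w := fun t => u (Γ.arc e t)) hst hα.1 hα.2
        ((Γ.continuousOn_comp_arc hu.1 e).mono (Icc_subset_Icc hα.1 le_rfl)) (fun r hr => by
          have hI : r ∈ Ioo (0 : ℝ) 1 := ⟨hα.1.trans_lt hr.1, hr.2⟩
          exact (hu.2.1 e r hI
            ⟨Γ.arc_mem_support (Ioo_subset_Icc_self hI), hαΓ r hr⟩).2) hsc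
      simp only [he] at h2
      linarith
    · have h2 := hus.sub_eq_prim h hmin hα.1 hα.2.le le_rfl
      rw [he] at h2
      linarith
  refine ⟨e, he, ?_⟩
  by_cases hne : {t | t ∈ Icc (0 : ℝ) 1 ∧ Γ.arc e t ∈ Γ'}.Nonempty
  -- The last point of `Γ'` on the arc; after it the equation holds up to the vertex.
  · obtain ⟨α, ⟨hα, hαΓ⟩, hαmax⟩ := (isCompact_arc_preimage e hΓ'c).exists_isGreatest hne
    have hα1 : α ≠ 1 := by rintro rfl; exact hx (he ▸ hαΓ)
    have hα' : α ∈ Ico (0 : ℝ) 1 := ⟨hα.1, hα.2.lt_of_ne hα1⟩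
    exact ⟨α, hα', Or.inl hαΓ, key α hα' fun r hr hrΓ =>
      not_lt.2 (hαmax ⟨⟨hα.1.trans hr.1.le, hr.2.le⟩, hrΓ⟩) hr.1⟩
  · have hno : ∀ t ∈ Icc (0 : ℝ) 1, Γ.arc e t ∉ Γ' := fun t ht htΓ => hne ⟨t, ht, htΓ⟩
    have h0 : (0 : ℝ) ∈ Ico (0 : ℝ) 1 := ⟨le_rfl, zero_lt_one⟩
    exact ⟨0, h0, Or.inr ⟨rfl, hno⟩, key 0 h0 fun r hr => hno r (Ioo_subset_Icc_self hr)⟩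

/-- Inside an arc and outside `Γ'` a solution is transported from a vertex or a point of `Γ'`. -/
theorem IsSolutionIn.exists_transport (hu : 𝓗.IsSolutionIn a (Γ.support \ Γ') u)
    (hus : 𝓗.IsSub a u) (h : ∀ e, 𝓗.LevelNonempty a e)
    (hdich : ∀ e, (∀ s ∈ Icc (0 : ℝ) 1, ∃ p, 𝓗.H e s p < a) ∨
      ∀ s ∈ Icc (0 : ℝ) 1, ∀ p, a ≤ 𝓗.H e s p) [Finite E]
    (hΓ'c : IsClosed Γ') (hr : r ∈ Ioo (0 : ℝ) 1) (hx : Γ.arc e r ∉ Γ') :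
    ∃ s ∈ Icc (0 : ℝ) 1, Γ.arc e s ∈ Γ' ∪ Γ.vertices ∧
      u (Γ.arc e s) + 𝓗.arcDist a e s r ≤ u (Γ.arc e r) := by
  set T : Set ℝ := {t | t ∈ Icc (0 : ℝ) 1 ∧ Γ.arc e t ∈ Γ' ∪ Γ.vertices}
  have hT : IsCompact T :=
    isCompact_arc_preimage e (hΓ'c.union Γ.finite_vertices.isClosed)
  have hrT : r ∉ T := fun hrT => hrT.2.elim hx (Γ.arc_notMem_vertices hr)
  obtain ⟨α, ⟨hαT, hαr⟩, hαmax⟩ := (hT.inter_right isClosed_Iic).exists_isGreatest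
    (⟨0, ⟨⟨le_rfl, zero_le_one⟩, Or.inr (Γ.arc_zero_mem_vertices e)⟩, hr.1.le⟩ :
      (T ∩ Iic r).Nonempty)
  obtain ⟨β, ⟨hβT, hβr⟩, hβmin⟩ := (hT.inter_right isClosed_Ici).exists_isLeast
    (⟨1, ⟨⟨zero_le_one, le_rfl⟩, Or.inr (Γ.arc_one_mem_vertices e)⟩, hr.2.le⟩ :
      (T ∩ Ici r).Nonempty)
  have hαr' : α < r := lt_of_le_of_ne hαr fun h => hrT (h ▸ hαT)
  have hβr' : r < β := lt_of_le_of_ne hβr fun h => hrT (h ▸ hβT)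
  rcases hdich e with hst | hmin
  · rcases le_or_le_of_isViscSuperAt (w := fun t => u (Γ.arc e t)) hst hαT.1.1 hβT.1.2
      ⟨hαr', hβr'⟩ ((Γ.continuousOn_comp_arc hu.1 e).mono (Icc_subset_Icc hαT.1.1 hβT.1.2))
      (fun t ht => by
        have hI : t ∈ Ioo (0 : ℝ) 1 := ⟨hαT.1.1.trans_lt ht.1, ht.2.trans_le hβT.1.2⟩
        refine (hu.2.1 e t hI ⟨Γ.arc_mem_support (Ioo_subset_Icc_self hI), fun htΓ => ?_⟩).2
        have htT : t ∈ T := ⟨Ioo_subset_Icc_self hI, Or.inl htΓ⟩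
        rcases le_total t r with htr | htr
        · exact not_lt.2 (hαmax ⟨htT, htr⟩) ht.1
        · exact not_lt.2 (hβmin ⟨htT, htr⟩) ht.2) with h1 | h1
    · exact ⟨α, hαT.1, hαT.2, by rwa [arcDist_of_le (h e) hαr'.le]⟩
    · exact ⟨β, hβT.1, hβT.2, by rwa [arcDist_of_ge (h e) hβr'.le]⟩
  · refine ⟨α, hαT.1, hαT.2, ?_⟩
    rw [arcDist_of_le (h e) hαr'.le, ← hus.sub_eq_prim h hmin hαT.1.1 hαr'.le hr.2.le]
    linarith

/-- Only `v ≤ u` needs an argument beyond maximality. The hypothesis `hcyc` excludes the zero cycle,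
disjoint from `Γ'`, that a vertex with `u < v` would generate; `exists_transport` carries the
inequality from the vertices and `Γ'` into the arcs. -/
theorem IsSolutionIn.eqOn_hopfLax [Finite E] (hu : 𝓗.IsSolutionIn a (Γ.support \ Γ') u)
    (hn : 𝓗.ClosedCurvesNonneg a) (h : ∀ e, 𝓗.LevelNonempty a e)
    (hdich : ∀ e, (∀ s ∈ Icc (0 : ℝ) 1, ∃ p, 𝓗.H e s p < a) ∨
      ∀ s ∈ Icc (0 : ℝ) 1, ∀ p, a ≤ 𝓗.H e s p)
    (hΓ'c : IsClosed Γ') (hΓ' : Γ' ⊆ Γ.support) (hne : Γ'.Nonempty)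
    (hg : 𝓗.IsAdmissibleTrace a Γ' g) (hug : EqOn u g Γ')
    (hcyc : ∀ ξ, Γ.IsCycle ξ → (ξ.map (𝓗.sigma a)).sum = 0 →
      ∃ e ∈ ξ, ∃ t ∈ Icc (0 : ℝ) 1, Γ.arc e t ∈ Γ') :
    EqOn u (𝓗.hopfLax a Γ' g) Γ.support := by
  have hus := hu.isSub hn h hΓ'c hg hug
  set v := 𝓗.hopfLax a Γ' g
  have hvs : 𝓗.IsSub a v := isSub_hopfLax hn h hΓ' hne hg
  have huv : EqOn u v Γ' := fun y hy => (hug hy).trans (hopfLax_eq hn hΓ' hg hy).symm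
  have hle : ∀ x ∈ Γ.support, u x ≤ v x := fun x hx =>
    hus.le_hopfLax h hΓ' hne (fun y hy => (hug hy).le) hx
  have hvert : ∀ x ∈ Γ.vertices, v x ≤ u x := by
    by_contra! hcon
    obtain ⟨x₀, hx₀V, hx₀⟩ := hcon
    set B : Set E := {e | u (Γ.arc e 0) < v (Γ.arc e 0) ∧
      u (Γ.arc e 1) = u (Γ.arc e 0) + 𝓗.sigma a e ∧ ∀ t ∈ Icc (0 : ℝ) 1, Γ.arc e t ∉ Γ'}
    have step : ∀ x ∈ Γ.vertices, u x < v x → ∃ e ∈ B, Γ.arc e 1 = x := by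
      intro x hxV hx
      have hxΓ : x ∉ Γ' := fun hxΓ => hx.ne (huv hxΓ)
      obtain ⟨e, he, α, hα, hα', heq⟩ := hu.exists_incoming hus h hdich hΓ'c hxV hxΓ
      have h1 := hvs e α 1 hα.1 hα.2.le le_rfl
      rw [he] at h1
      have hlt : u (Γ.arc e α) < v (Γ.arc e α) := by linarith
      rcases hα' with hαΓ | ⟨rfl, hno⟩
      · exact absurd (huv hαΓ) hlt.ne
      · exact ⟨e, ⟨hlt, by rw [he, sigma_eq (h e), heq], hno⟩, he⟩
    obtain ⟨e₀, he₀, -⟩ := step x₀ hx₀V hx₀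
    obtain ⟨ξ, hξ, hξB⟩ := EmbeddedNetwork.exists_isCycle_of_forall_exists_pred ⟨e₀, he₀⟩
      fun e he => step _ (Γ.arc_zero_mem_vertices e) he.1
    obtain ⟨x, hx⟩ := hξ.2
    have hsum := EmbeddedNetwork.sum_eq_of_isPath hx fun e he => (hξB e he).2.1
    rw [sub_self] at hsum
    obtain ⟨e, he, t, ht, htΓ⟩ := hcyc ξ hξ hsum
    exact (hξB e he).2.2 t ht htΓ
  intro x hx
  refine (hle x hx).antisymm ?_
  by_cases hxV : x ∈ Γ.vertices
  · exact hvert x hxV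
  by_cases hxΓ : x ∈ Γ'
  · exact (huv hxΓ).ge
  obtain ⟨e, r, hr, rfl⟩ := mem_iUnion.1 hx
  have hrI := Γ.mem_Ioo_of_notMem_vertices hr hxV
  obtain ⟨s, hs, hsT, hsr⟩ := hu.exists_transport hus h hdich hΓ'c hrI hxΓ
  have h1 := hvs.le_arcDist h hs hr (e := e)
  have h2 : v (Γ.arc e s) ≤ u (Γ.arc e s) := hsT.elim (fun hsΓ => (huv hsΓ).ge) (hvert _)
  linarith

/-! ### Existence -/

theorem isSolutionIn_hopfLax [Finite E] (hn : 𝓗.ClosedCurvesNonneg a)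
    (h : ∀ e, 𝓗.LevelNonempty a e) (hΓ'c : IsClosed Γ') (hΓ' : Γ' ⊆ Γ.support)
    (hne : Γ'.Nonempty) (hg : 𝓗.IsAdmissibleTrace a Γ' g) :
    𝓗.IsSolutionIn a (Γ.support \ Γ') (𝓗.hopfLax a Γ' g) := by
  have hv := isSub_hopfLax hn h hΓ' hne hg
  exact ⟨hv.continuousOn h, fun e s hs hsU => ⟨hv.isViscSubAt h hs,
    isViscSuperAt_hopfLax hn h hΓ'c hΓ' hne hg hs hsU.2⟩, fun x hx =>
    exists_stateConstraintAtOne_hopfLax hn h hΓ'c hΓ' hne hg hx.1 hx.2.2⟩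

/-- Around a zero cycle the inequalities sum to an equality, so each edge is saturated, and then so
is every portion of it. -/
theorem IsSub.sub_eq_of_mem_aubryEdges (hf : 𝓗.IsSub 𝓗.criticalValue f)
    (h : ∀ e, 𝓗.LevelNonempty 𝓗.criticalValue e) (he : e ∈ 𝓗.aubryEdges) (hs : 0 ≤ s)
    (hst : s ≤ t) (ht : t ≤ 1) : f (Γ.arc e t) - f (Γ.arc e s) =
      𝓗.prim 𝓗.criticalValue e t - 𝓗.prim 𝓗.criticalValue e s := by
  obtain ⟨ξ, ⟨-, x, hx⟩, hsum, heξ⟩ := he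
  have h1 := EmbeddedNetwork.eq_of_sum_le_of_isPath hx (hf.le_sigma h) (by simp [hsum]) e heξ
  rw [sigma_eq (h e)] at h1
  have h2 := hf e 0 s le_rfl hs (hst.trans ht)
  have h3 := hf e s t hs hst ht
  have h4 := hf e t 1 (hs.trans hst) ht le_rfl
  linarith

theorem IsSub.eq_add_prim_of_mem_aubryEdges (hf : 𝓗.IsSub 𝓗.criticalValue f)
    (h : ∀ e, 𝓗.LevelNonempty 𝓗.criticalValue e) (he : e ∈ 𝓗.aubryEdges)
    (hs : s ∈ Icc (0 : ℝ) 1) (ht : t ∈ Icc (0 : ℝ) 1) : f (Γ.arc e t) = f (Γ.arc e s) +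
      (𝓗.prim 𝓗.criticalValue e t - 𝓗.prim 𝓗.criticalValue e s) := by
  have h1 := hf.sub_eq_of_mem_aubryEdges h he le_rfl ht.1 ht.2
  have h2 := hf.sub_eq_of_mem_aubryEdges h he le_rfl hs.1 hs.2
  linarith

theorem IsSub.isViscSuperAt_of_mem_aubrySet (hf : 𝓗.IsSub 𝓗.criticalValue f)
    (h : ∀ e, 𝓗.LevelNonempty 𝓗.criticalValue e) (hs : s ∈ Ioo (0 : ℝ) 1)
    (hx : Γ.arc e s ∈ 𝓗.aubrySet) :
    IsViscSuperAt (𝓗.H e) 𝓗.criticalValue (fun t => f (Γ.arc e t)) s := by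
  have hs' := Ioo_subset_Icc_self hs
  obtain ⟨d, hd, t, ht, hdt⟩ := hx
  rcases Γ.eq_or_eq_rev_of_arc_eq hs' ht (Γ.arc_notMem_vertices hs) hdt.symm with
    ⟨rfl, rfl⟩ | ⟨rfl, rfl⟩
  · refine isViscSuperAt_of_le_prim (h d) hs' ?_
    filter_upwards [Icc_mem_nhds hs.1 hs.2] with r hr
    exact (hf.eq_add_prim_of_mem_aubryEdges h hd hs' hr).le
  · refine isViscSuperAt_of_le_primMinus (h e) hs' ?_
    filter_upwards [Icc_mem_nhds hs.1 hs.2] with r hr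
    have := hf.eq_add_prim_of_mem_aubryEdges h hd ht (one_sub_mem hr)
    rw [Γ.arc_rev' hs', Γ.arc_rev' hr] at this
    exact this.le

theorem IsSub.exists_stateConstraintAtOne_of_mem_aubrySet (hf : 𝓗.IsSub 𝓗.criticalValue f)
    (h : ∀ e, 𝓗.LevelNonempty 𝓗.criticalValue e) (hxV : x ∈ Γ.vertices)
    (hx : x ∈ 𝓗.aubrySet) : ∃ e, Γ.arc e 1 = x ∧
      StateConstraintAtOne (𝓗.H e) 𝓗.criticalValue (fun t => f (Γ.arc e t)) := by
  obtain ⟨e, he, hex⟩ : ∃ e ∈ 𝓗.aubryEdges, Γ.arc e 1 = x := by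
    obtain ⟨d, hd, t, ht, rfl⟩ := hx
    rcases Γ.eq_zero_or_one_of_mem_vertices ht hxV with rfl | rfl
    -- The vertex condition needs an incoming arc, so an outgoing Aubry edge is replaced by its
    -- predecessor in the cycle.
    · obtain ⟨ξ, hξ, hsum, hdξ⟩ := hd
      obtain ⟨e, heξ, he⟩ := EmbeddedNetwork.IsCycle.exists_pred hξ hdξ
      exact ⟨e, ⟨ξ, hξ, hsum, heξ⟩, he⟩
    · exact ⟨d, hd, rfl⟩
  refine ⟨e, hex, stateConstraintAtOne_of_le_prim (h e) ?_⟩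
  filter_upwards [Ioo_mem_nhdsLT zero_lt_one] with t ht
  exact (hf.eq_add_prim_of_mem_aubryEdges h he ⟨zero_le_one, le_rfl⟩
    (Ioo_subset_Icc_self ht)).le

end NetworkHamiltonian

/-! ### The critical and supercritical cases. -/

theorem theorem6p8 {N : ℕ} {E : Type*} [Finite E] [Nonempty E] (Γ : EmbeddedNetwork N E)
    (𝓗 : NetworkHamiltonian Γ) (h𝓗 : 𝓗.ConstantMinOnExtremalArcs) (a : ℝ)
    (Γ' : Set (EuclideanSpace ℝ (Fin N))) (hΓ' : IsClosed Γ') (hΓ'Γ : Γ' ⊆ Γ.support)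
    (g : EuclideanSpace ℝ (Fin N) → ℝ) (hg : 𝓗.IsAdmissibleTrace a Γ' g) :
    -- critical case
    (a = 𝓗.criticalValue → Γ' ⊆ 𝓗.aubrySet →
      (∀ e ∈ 𝓗.aubryEdges, (Γ' ∩ Γ.arc e '' Icc 0 1).Nonempty) →
      (∀ x ∈ Γ.support, IsLeast (𝓗.hopfLaxValues a Γ' g x) (𝓗.hopfLax a Γ' g x)) ∧
      𝓗.IsSolutionIn a Γ.support (𝓗.hopfLax a Γ' g) ∧
      EqOn (𝓗.hopfLax a Γ' g) g Γ' ∧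
      ∀ u : EuclideanSpace ℝ (Fin N) → ℝ, 𝓗.IsSolutionIn a Γ.support u → EqOn u g Γ' →
        EqOn u (𝓗.hopfLax a Γ' g) Γ.support) ∧
    -- supercritical case
    (𝓗.criticalValue < a → Γ'.Nonempty →
      (∀ x ∈ Γ.support, IsLeast (𝓗.hopfLaxValues a Γ' g x) (𝓗.hopfLax a Γ' g x)) ∧
      𝓗.IsSolutionIn a (Γ.support \ Γ') (𝓗.hopfLax a Γ' g) ∧
      EqOn (𝓗.hopfLax a Γ' g) g Γ' ∧
      ∀ u : EuclideanSpace ℝ (Fin N) → ℝ, 𝓗.IsSolutionIn a (Γ.support \ Γ') u → EqOn u g Γ' →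
        EqOn u (𝓗.hopfLax a Γ' g) Γ.support) := by
  constructor
  · rintro rfl hΓ'A hmeet
    have hL : ∀ e, 𝓗.LevelNonempty 𝓗.criticalValue e :=
      NetworkHamiltonian.levelNonempty_of_criticalValue_le le_rfl
    have hn : 𝓗.ClosedCurvesNonneg 𝓗.criticalValue :=
      NetworkHamiltonian.closedCurvesNonneg_of_criticalValue_le le_rfl
    have hdich := NetworkHamiltonian.forall_exists_H_lt_or_forall_le_H h𝓗
      𝓗.a₀_le_criticalValue
    -- In the critical case nonemptiness of `Γ'` is a consequence: an Aubry edge exists and `Γ'`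
    -- meets it.
    have hne : Γ'.Nonempty := by
      obtain ⟨e, he⟩ := NetworkHamiltonian.nonempty_aubryEdges h𝓗
      exact (hmeet e he).mono inter_subset_left
    have hv := NetworkHamiltonian.isSub_hopfLax hn hL hΓ'Γ hne hg
    have hsol := NetworkHamiltonian.isSolutionIn_hopfLax hn hL hΓ' hΓ'Γ hne hg
    refine ⟨fun x hx => NetworkHamiltonian.isLeast_hopfLax hn hL hΓ' hΓ'Γ hne hg hx,
      ⟨hsol.1, fun e s hs hsU => ⟨hv.isViscSubAt hL hs, ?_⟩, fun x hx => ?_⟩,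
      NetworkHamiltonian.hopfLax_eq hn hΓ'Γ hg, fun u hu hug => ?_⟩
    · by_cases hsΓ : Γ.arc e s ∈ Γ'
      · exact hv.isViscSuperAt_of_mem_aubrySet hL hs (hΓ'A hsΓ)
      · exact (hsol.2.1 e s hs ⟨hsU, hsΓ⟩).2
    · by_cases hxΓ : x ∈ Γ'
      · exact hv.exists_stateConstraintAtOne_of_mem_aubrySet hL hx.1 (hΓ'A hxΓ)
      · exact hsol.2.2 x ⟨hx.1, hx.2, hxΓ⟩
    · refine (hu.mono sdiff_subset).eqOn_hopfLax hn hL hdich hΓ' hΓ'Γ hne hg hug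
        fun ξ hξ hsum => ?_
      obtain ⟨e, he⟩ := List.exists_mem_of_ne_nil _ hξ.1
      obtain ⟨_, hxΓ, t, ht, rfl⟩ := hmeet e ⟨ξ, hξ, hsum, he⟩
      exact ⟨e, he, t, ht, hxΓ⟩
  · intro hca hne
    have hL : ∀ e, 𝓗.LevelNonempty a e :=
      NetworkHamiltonian.levelNonempty_of_criticalValue_le hca.le
    have hn : 𝓗.ClosedCurvesNonneg a :=
      NetworkHamiltonian.closedCurvesNonneg_of_criticalValue_le hca.le
    have hdich := NetworkHamiltonian.forall_exists_H_lt_or_forall_le_H h𝓗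
      (𝓗.a₀_le_criticalValue.trans hca.le)
    exact ⟨fun x hx => NetworkHamiltonian.isLeast_hopfLax hn hL hΓ' hΓ'Γ hne hg hx,
      NetworkHamiltonian.isSolutionIn_hopfLax hn hL hΓ' hΓ'Γ hne hg,
      NetworkHamiltonian.hopfLax_eq hn hΓ'Γ hg,
      -- Above the critical value every cycle has positive length, so the condition on zero cycles
      -- is vacuous.
      fun u hu hug => hu.eqOn_hopfLax hn hL hdich hΓ' hΓ'Γ hne hg hug fun ξ hξ hsum =>
        absurd hsum (NetworkHamiltonian.sum_sigma_pos hca hξ).ne'⟩
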